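/- Consider two exponential single-server queues in tandem, both with infinite capacity: Poisson arrivals at rate $\lambda>0$ to the first queue, service rates $\mu_1$ (first queue) and $\mu_2$ (second queue). Assume $\lambda<\mu_2<\mu_1$, put $\rho_2=\lambda/\mu_2$ and fix $z\in[\rho_2,1)$. Let $Y_t$ (the level) and $J_t$ (the phase) be the numbers of customers in the second and in the first queue. Away from level $0$ the chain $(Y_t,J_t)$ has the transition-rate blocks $Q_0,Q_1,Q_2$ (level up, level unchanged, level down), indexed by phases $i,j\ge 0$, whose nonzero entries are $$(Q_0)_{i+1,i}=\mu_1,\quad (Q_2)_{i,i}=\mu_2,\quad (Q_1)_{i,i+1}=\lambda,\quad (Q_1)_{i,i}=-(\lambda+\mu_1\mathbf 1_{\{i\ge1\}}+\mu_2).$$ Let $\mathbf w=(w_0,w_1,\dots)$ be the unique row vector with $w_0=1$ and $\mathbf w(Q_0+zQ_1+z^2Q_2)=\mathbf 0$, that is, $\mu_1w_1=(\lambda+\mu_2(1-z))zw_0$ and $\mu_1w_{k+1}=(\lambda+\mu_1+\mu_2(1-z))zw_k-\lambda zw_{k-1}$ for $k\ge1$. Then $w_k>0$ for all $k$, $\mathbf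 w\in\ell^1$, and $\mathbf wR=z\mathbf w$, where $R$ is the minimal nonnegative solution of $Q_0+RQ_1+R^2Q_2=0$ (which exists). Define $$\tilde\lambda_0=\mu_2z,\qquad \tilde\lambda_i=\tilde\lambda_{i-1}\frac{w_{i-1}}{w_i}+\mu_2z-\mu_1\quad(i\ge1).$$ Then $\tilde\lambda_i>0$ for all $i\ge0$. Modify the network by replacing, while the second queue is empty and the first queue holds $i$ customers, the arrival rate $\lambda$ by $\tilde\lambda_i$, all other rates being unchanged. The resulting generator is the derivative at time $0$ (entrywise) of exactly one honest Markov transition function $P(t)$, $t\ge0$, on $\{0,1,\dots\}\times\{0,1,\dots\}$. There is a constant $c>0$ such that, with $$\pi_{n,i}=c\,z^n w_i\qquad(n,i\ge0),$$ $\pi$ is the unique stationary distribution of the modified network (the unique probability distribution with $\pi P(t)=\pi$ for all $t\ge0$) and also its limiting distribution: $\lim_{t\to\infty}\mathbb P(Y_t=n,J_t=i)=\pi_{n,i}$ for every initial distribution. In particular the stationary distribution decays at rate exactly $z$: both $z^{-n}\sum_i\pi_{n,i}$ and, for each fixed $i$, $z^{-n}\pi_{n,i}$ converge to a positive constant as $n\to\infty$.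 -/

import Mathlib

open Filter Topology
open scoped NNReal

namespace TandemQueue

/-! Quasi-birth-and-death chains on `ℕ × ℕ`; a state is the pair `(level, phase)`. -/

/-- The block tridiagonal generator with blocks `Q₀` (level up), `Q₁` (same level, at levels
`n ≥ 1`), `Q₂` (level down) and `B` (within level `0`). -/
def qbdGenerator (B Q₀ Q₁ Q₂ : Matrix ℕ ℕ ℝ) : Matrix (ℕ × ℕ) (ℕ × ℕ) ℝ := fun x y =>
  if y.1 = x.1 + 1 then Q₀ x.2 y.2
  else if y.1 = x.1 then (if x.1 = 0 then B x.2 y.2 else Q₁ x.2 y.2)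
  else if x.1 = y.1 + 1 then Q₂ x.2 y.2
  else 0

/-- Nonnegative solutions `R` of the matrix equation `Q₀ + R Q₁ + R² Q₂ = 0` (with `R²` required
to be a convergent matrix product; each column of `Q₁` and `Q₂` below has finite support). -/
def rateEquationSolutions (Q₀ Q₁ Q₂ : Matrix ℕ ℕ ℝ) : Set (Matrix ℕ ℕ ℝ) :=
  {R | (∀ i j, 0 ≤ R i j) ∧ (∀ i j, Summable fun k => R i k * R k j) ∧
    ∀ i j, Q₀ i j + ∑' k, R i k * Q₁ k j + ∑' k, (∑' l, R i l * R l k) * Q₂ k j = 0}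

/-- `R` is the minimal (entrywise least) nonnegative solution of `Q₀ + R Q₁ + R² Q₂ = 0`. -/
def IsRateMatrix (Q₀ Q₁ Q₂ R : Matrix ℕ ℕ ℝ) : Prop :=
  R ∈ rateEquationSolutions Q₀ Q₁ Q₂ ∧
    ∀ R' ∈ rateEquationSolutions Q₀ Q₁ Q₂, ∀ i j, R i j ≤ R' i j

/-! Continuous-time Markov chains on a countable state space. -/

/-- `P` is an honest (row sums one) Markov transition function whose generator is `Q`, that is,
`P'(0) = Q` entrywise: `P t x y` is the probability to be in `y` at time `t` when starting
in `x`. -/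
structure IsTransitionFunction {S : Type*} [DecidableEq S] (Q : Matrix S S ℝ)
    (P : ℝ≥0 → Matrix S S ℝ) : Prop where
  nonneg : ∀ t x y, 0 ≤ P t x y
  hasSum_one : ∀ t x, HasSum (fun y => P t x y) 1
  zero : P 0 = 1
  chapman_kolmogorov : ∀ s t x y, HasSum (fun k => P s x k * P t k y) (P (s + t) x y)
  generator : ∀ x y, Tendsto (fun h : ℝ≥0 => (P h x y - (1 : Matrix S S ℝ) x y) / (h : ℝ))
    (𝓝[>] 0) (𝓝 (Q x y))

/-- `p` is a probability distribution on `S`. -/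
def IsDistribution {S : Type*} (p : S → ℝ) : Prop :=
  (∀ x, 0 ≤ p x) ∧ HasSum p 1

/-- `p` is a stationary distribution of the chain: a probability distribution with `p P(t) = p`
for all `t`. -/
def IsStationary {S : Type*} (P : ℝ≥0 → Matrix S S ℝ) (p : S → ℝ) : Prop :=
  IsDistribution p ∧ ∀ t y, HasSum (fun x => p x * P t x y) (p y)

/-- `p` is the limiting distribution: from every initial distribution, the probability to be in
state `y` at time `t` tends to `p y`. -/
def IsLimiting {S : Type*} (P : ℝ≥0 → Matrix S S ℝ) (p : S → ℝ) : Prop :=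
  ∀ ν : S → ℝ, IsDistribution ν →
    ∀ y, Tendsto (fun t : ℝ≥0 => ∑' x, ν x * P t x y) atTop (𝓝 (p y))

/-- The sequence `a` decays geometrically at rate exactly `z`: `a n / z ^ n` tends to a positive
constant. -/
def HasDecayRate (a : ℕ → ℝ) (z : ℝ) : Prop :=
  0 < z ∧ ∃ κ : ℝ, 0 < κ ∧ Tendsto (fun n => a n / z ^ n) atTop (𝓝 κ)

/-! The tandem network: the level is the number of customers in the second queue, the phase the
number in the first queue; arrival rate `lam`, service rates `μ₁` and `μ₂`. -/

/-- A service completion at the first queue: `(n, i + 1) → (n + 1, i)` at rate `μ₁`. -/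
def blockUp (μ₁ : ℝ) : Matrix ℕ ℕ ℝ := fun i j => if i = j + 1 then μ₁ else 0

/-- A service completion at the second queue: `(n + 1, i) → (n, i)` at rate `μ₂`. -/
def blockDown (μ₂ : ℝ) : Matrix ℕ ℕ ℝ := fun i j => if i = j then μ₂ else 0

/-- The diagonal block at the levels `n ≥ 1`: arrivals at rate `lam`. -/
def blockLocal (lam μ₁ μ₂ : ℝ) : Matrix ℕ ℕ ℝ := fun i j =>
  if j = i + 1 then lam
  else if j = i then -(lam + (if i = 0 then 0 else μ₁) + μ₂)
  else 0

/-- The diagonal block at level `0`: arrivals at the phase-dependent rate `a i`. -/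
def blockZero (a : ℕ → ℝ) (μ₁ : ℝ) : Matrix ℕ ℕ ℝ := fun i j =>
  if j = i + 1 then a i
  else if j = i then -(a i + (if i = 0 then 0 else μ₁))
  else 0

/-- The generator of the tandem network in which the arrival rate is `lam` while the second queue
is nonempty, and `a i` while the second queue is empty and the first holds `i` customers. -/
def generator (lam μ₁ μ₂ : ℝ) (a : ℕ → ℝ) : Matrix (ℕ × ℕ) (ℕ × ℕ) ℝ :=
  qbdGenerator (blockZero a μ₁) (blockUp μ₁) (blockLocal lam μ₁ μ₂) (blockDown μ₂)

/-- The solution `w`, normalized by `w 0 = 1`, of `w (Q₀ + z Q₁ + z² Q₂) = 0`, computed column by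
column from the equations
`-(lam + μ₂ (1 - z)) z w₀ + μ₁ w₁ = 0` and
`lam z w_k - (lam + μ₁ + μ₂ (1 - z)) z w_{k+1} + μ₁ w_{k+2} = 0`. -/
noncomputable def w (lam μ₁ μ₂ z : ℝ) : ℕ → ℝ
  | 0 => 1
  | 1 => (lam + μ₂ * (1 - z)) * z / μ₁
  | k + 2 => ((lam + μ₁ + μ₂ * (1 - z)) * z * w lam μ₁ μ₂ z (k + 1)
      - lam * z * w lam μ₁ μ₂ z k) / μ₁

/-- The modified arrival rates at level `0`. -/
noncomputable def modifiedRate (lam μ₁ μ₂ z : ℝ) : ℕ → ℝ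
  | 0 => μ₂ * z
  | i + 1 => modifiedRate lam μ₁ μ₂ z i * (w lam μ₁ μ₂ z i / w lam μ₁ μ₂ z (i + 1))
      + μ₂ * z - μ₁

end TandemQueue

namespace TandemQueue

/-! ### The level vector `w` and the modified arrival rates -/

section LevelVector

variable {lam μ₁ μ₂ z : ℝ}

/-! The modified rates are chosen so that `z ^ n * w i` satisfies global balance. At levels `n ≥ 1`
balance is the equation `w (Q₀ + z Q₁ + z² Q₂) = 0`; at level `0` it is the recursion defining the
modified rates. What has to be shown is that these rates are positive and bounded and that the
resulting chain is well behaved.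

The recurrence for `w` has characteristic roots `0 < x₁ ≤ z ≤ x₂ < 1` (`exists_roots`), and the
ratios of consecutive `w` lie in `[x₁, x₂]` (`w_succ_bounds`). Hence `w` is positive with
geometrically bounded tails. Summing the recurrence gives `μ₁ ∑_{k ≥ 1} w k = μ₂ z ∑ w k`, and the
recursion for the rates then telescopes to `rate i * w i = (μ₁ - μ₂ z) ∑_{k > i} w k`
(`modifiedRate_mul_w`). Positivity is immediate, and the tail bound makes the rates bounded.

After uniformization, the minimal `R` is the increasing limit of a fixed point iteration started at
`0`. The iterates satisfy `w R ≤ z w`; the total mass of the deficit `z w - w R` is finite and at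
most `θ < 1` times itself, so it vanishes (`tsum_mul_rateLimit_eq`).

Since the rates are bounded, the generator acts boundedly on `ℓ¹`, and its exponential is an honest
transition function. Uniqueness follows from the backward equation and a contraction on short time
intervals. For convergence, the `ℓ¹` distance to the stationary law decreases in time; a limit point
of `P t x ·` therefore loses no further distance under `P 1`, and since `P 1` is positive this
forces it to equal the stationary law (`eq_zero_of_tsum_abs_le`). Uniqueness of the stationary law
follows by starting the chain from another one. -/

theorem mul_w_one (hμ₁ : μ₁ ≠ 0) :
    μ₁ * w lam μ₁ μ₂ z 1 = (lam + μ₂ * (1 - z)) * z := by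
  rw [w]
  field_simp

theorem mul_w_add_two (hμ₁ : μ₁ ≠ 0) (k : ℕ) :
    μ₁ * w lam μ₁ μ₂ z (k + 2) = (lam + μ₁ + μ₂ * (1 - z)) * z * w lam μ₁ μ₂ z (k + 1)
      - lam * z * w lam μ₁ μ₂ z k := by
  rw [w]
  field_simp

theorem tsum_column_zero (v : ℕ → ℝ) :
    ∑' i, v i * (blockUp μ₁ i 0 + z * blockLocal lam μ₁ μ₂ i 0 + z ^ 2 * blockDown μ₂ i 0)
      = μ₁ * v 1 - (lam + μ₂ * (1 - z)) * z * v 0 := by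
  rw [tsum_eq_sum (s := {0, 1})]
  · rw [Finset.sum_pair zero_ne_one]
    simp [blockUp, blockLocal, blockDown]
    ring
  · intro i hi
    simp only [Finset.mem_insert, Finset.mem_singleton, not_or] at hi
    simp [blockUp, blockLocal, blockDown, hi, Ne.symm hi.1]

theorem tsum_column_succ (v : ℕ → ℝ) (j : ℕ) :
    ∑' i, v i * (blockUp μ₁ i (j + 1) + z * blockLocal lam μ₁ μ₂ i (j + 1)
        + z ^ 2 * blockDown μ₂ i (j + 1))
      = μ₁ * v (j + 2) - ((lam + μ₁ + μ₂ * (1 - z)) * z * v (j + 1) - lam * z * v j) := by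
  rw [tsum_eq_sum (s := {j, j + 1, j + 2})]
  · rw [Finset.sum_insert (by simp), Finset.sum_pair (by simp)]
    simp [blockUp, blockLocal, blockDown, show j ≠ j + 1 + 1 by lia]
    ring
  · intro i hi
    simp only [Finset.mem_insert, Finset.mem_singleton, not_or] at hi
    simp [blockUp, blockLocal, blockDown, hi, Ne.symm hi.1, Ne.symm hi.2.1]

theorem column_equations_iff (hμ₁ : μ₁ ≠ 0) (v : ℕ → ℝ) :
    (v 0 = 1 ∧ ∀ j, ∑' i, v i * (blockUp μ₁ i j + z * blockLocal lam μ₁ μ₂ i j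
      + z ^ 2 * blockDown μ₂ i j) = 0) ↔ v = w lam μ₁ μ₂ z := by
  constructor
  · rintro ⟨h0, h⟩
    have h1 : v 1 = w lam μ₁ μ₂ z 1 := by
      have := h 0
      rw [tsum_column_zero, h0, ← mul_w_one hμ₁] at this
      exact mul_left_cancel₀ hμ₁ (by linarith)
    have key : ∀ n, v n = w lam μ₁ μ₂ z n ∧ v (n + 1) = w lam μ₁ μ₂ z (n + 1) := by
      intro n
      induction n with
      | zero => exact ⟨by rw [h0, w], h1⟩
      | succ n ih =>
        refine ⟨ih.2, mul_left_cancel₀ hμ₁ ?_⟩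
        have := h (n + 1)
        rw [tsum_column_succ, ih.1, ih.2] at this
        rw [mul_w_add_two hμ₁]
        exact sub_eq_zero.1 this
    exact funext fun n => (key n).1
  · rintro rfl
    refine ⟨by rw [w], fun j => ?_⟩
    cases j with
    | zero => rw [tsum_column_zero, mul_w_one hμ₁]; simp [w]
    | succ j => rw [tsum_column_succ, mul_w_add_two hμ₁, sub_self]

/-- The roots of the characteristic equation of the recurrence for `w`. -/
theorem exists_roots (hlam : 0 < lam) (hstable : lam < μ₂) (hμ : μ₂ < μ₁)
    (hz : lam / μ₂ ≤ z) (hz1 : z < 1) :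
    ∃ x₁ x₂ : ℝ, 0 < x₁ ∧ x₁ ≤ z ∧ z ≤ x₂ ∧ x₂ < 1 ∧
      μ₁ * (x₁ + x₂) = (lam + μ₁ + μ₂ * (1 - z)) * z ∧ μ₁ * (x₁ * x₂) = lam * z := by
  have hμ₂ : 0 < μ₂ := hlam.trans hstable
  have hμ₁ : 0 < μ₁ := hμ₂.trans hμ
  have hz0 : 0 < z := (div_pos hlam hμ₂).trans_le hz
  have hlz : lam ≤ z * μ₂ := (div_le_iff₀ hμ₂).1 hz
  set b := (lam + μ₁ + μ₂ * (1 - z)) * z with hb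
  have hb0 : 0 < b := by
    have : 0 < μ₂ * (1 - z) := mul_pos hμ₂ (sub_pos.2 hz1)
    positivity
  -- For `f x = μ₁ x² - b x + lam z`, `f z ≤ 0` puts `z` between the roots; `f 1 > 0` together with
  -- `b < 2 μ₁` puts both roots below `1`. The first uses `lam ≤ z μ₂`, the second `μ₂ z < μ₁`.
  have hfz : μ₁ * z ^ 2 - b * z + lam * z ≤ 0 := by
    have : μ₁ * z ^ 2 - b * z + lam * z = -(z * (1 - z) * (z * μ₂ - lam)) := by rw [hb]; ring
    rw [this, neg_nonpos]
    exact mul_nonneg (mul_nonneg hz0.le (sub_pos.2 hz1).le) (sub_nonneg.2 hlz)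
  have hf1 : 0 < μ₁ - b + lam * z := by
    have : μ₁ - b + lam * z = (1 - z) * (μ₁ - μ₂ * z) := by rw [hb]; ring
    rw [this]
    refine mul_pos (sub_pos.2 hz1) ?_
    nlinarith
  have hb2 : b < 2 * μ₁ := by nlinarith
  have hdisc : (2 * μ₁ * z - b) ^ 2 ≤ b ^ 2 - 4 * μ₁ * (lam * z) := by nlinarith
  set s := √(b ^ 2 - 4 * μ₁ * (lam * z)) with hs
  have hs2 : s ^ 2 = b ^ 2 - 4 * μ₁ * (lam * z) := Real.sq_sqrt ((sq_nonneg _).trans hdisc)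
  have hs0 : 0 ≤ s := Real.sqrt_nonneg _
  have habs : |2 * μ₁ * z - b| ≤ s := Real.abs_le_sqrt hdisc
  have hsb : s < b := by
    refine lt_of_pow_lt_pow_left₀ 2 hb0.le ?_
    rw [hs2]
    have : 0 < 4 * μ₁ * (lam * z) := by positivity
    linarith
  have hs1 : s < 2 * μ₁ - b := by
    refine lt_of_pow_lt_pow_left₀ 2 (by linarith) ?_
    rw [hs2]
    nlinarith
  obtain ⟨ha1, ha2⟩ := abs_le.1 habs
  refine ⟨(b - s) / (2 * μ₁), (b + s) / (2 * μ₁), div_pos (by linarith) (by linarith), ?_, ?_, ?_,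
    ?_, ?_⟩
  · rw [div_le_iff₀ (by linarith)]; linarith
  · rw [le_div_iff₀ (by linarith)]; linarith
  · rw [div_lt_one (by linarith)]; linarith
  · field_simp; ring
  · field_simp
    linear_combination -hs2

theorem w_succ_bounds (hμ₁ : 0 < μ₁) {x₁ x₂ : ℝ}
    (hx0 : 0 < x₁) (hx₁ : x₁ ≤ z) (hx₂ : z ≤ x₂)
    (hadd : μ₁ * (x₁ + x₂) = (lam + μ₁ + μ₂ * (1 - z)) * z) (hmul : μ₁ * (x₁ * x₂) = lam * z)
    (k : ℕ) : x₁ * w lam μ₁ μ₂ z k ≤ w lam μ₁ μ₂ z (k + 1) ∧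
      w lam μ₁ μ₂ z (k + 1) ≤ x₂ * w lam μ₁ μ₂ z k := by
  -- Subtracting one root times the previous term leaves a sequence that is geometric in the other
  -- root; the constants come from `w 1 = x₁ + x₂ - z`. Their signs give the two bounds.
  have key : w lam μ₁ μ₂ z (k + 1) - x₁ * w lam μ₁ μ₂ z k = (x₂ - z) * x₂ ^ k ∧
      w lam μ₁ μ₂ z (k + 1) - x₂ * w lam μ₁ μ₂ z k = (x₁ - z) * x₁ ^ k := by
    induction k with
    | zero =>
      have h1 : w lam μ₁ μ₂ z 1 = x₁ + x₂ - z := by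
        apply mul_left_cancel₀ hμ₁.ne'
        rw [mul_w_one hμ₁.ne']
        linear_combination -hadd
      have h0 : w lam μ₁ μ₂ z 0 = 1 := by rw [w]
      rw [zero_add, h1, h0]
      constructor <;> ring
    | succ k ih =>
      have h2 : w lam μ₁ μ₂ z (k + 2)
          = (x₁ + x₂) * w lam μ₁ μ₂ z (k + 1) - x₁ * x₂ * w lam μ₁ μ₂ z k := by
        apply mul_left_cancel₀ hμ₁.ne'
        rw [mul_w_add_two hμ₁.ne', ← hadd, ← hmul]
        ring
      rw [h2]
      constructor
      · linear_combination x₂ * ih.1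
      · linear_combination x₁ * ih.2
  have hx2 : 0 < x₂ := hx0.trans_le (hx₁.trans hx₂)
  constructor
  · have : 0 ≤ (x₂ - z) * x₂ ^ k := mul_nonneg (sub_nonneg.2 hx₂) (by positivity)
    linarith
  · have : (x₁ - z) * x₁ ^ k ≤ 0 :=
      mul_nonpos_of_nonpos_of_nonneg (sub_nonpos.2 hx₁) (by positivity)
    linarith

theorem w_pos (hlam : 0 < lam) (hstable : lam < μ₂) (hμ : μ₂ < μ₁)
    (hz : lam / μ₂ ≤ z) (hz1 : z < 1) (k : ℕ) : 0 < w lam μ₁ μ₂ z k := by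
  obtain ⟨x₁, x₂, h0, h1, h2, -, hadd, hmul⟩ := exists_roots hlam hstable hμ hz hz1
  induction k with
  | zero => rw [w]; exact one_pos
  | succ k ih =>
    exact (mul_pos h0 ih).trans_le
      (w_succ_bounds ((hlam.trans hstable).trans hμ) h0 h1 h2 hadd hmul k).1

theorem exists_w_ratio_bound (hlam : 0 < lam) (hstable : lam < μ₂) (hμ : μ₂ < μ₁)
    (hz : lam / μ₂ ≤ z) (hz1 : z < 1) :
    ∃ r : ℝ, 0 < r ∧ r < 1 ∧ ∀ i k, w lam μ₁ μ₂ z (k + i) ≤ r ^ k * w lam μ₁ μ₂ z i := by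
  obtain ⟨x₁, x₂, h0, h1, h2, h3, hadd, hmul⟩ := exists_roots hlam hstable hμ hz hz1
  have hr : 0 < x₂ := h0.trans_le (h1.trans h2)
  refine ⟨x₂, hr, h3, fun i k => ?_⟩
  induction k with
  | zero => simp
  | succ k ih =>
    rw [Nat.add_right_comm, pow_succ', mul_assoc]
    exact (w_succ_bounds ((hlam.trans hstable).trans hμ) h0 h1 h2 hadd hmul _).2.trans
      (mul_le_mul_of_nonneg_left ih hr.le)

theorem summable_w (hlam : 0 < lam) (hstable : lam < μ₂) (hμ : μ₂ < μ₁)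
    (hz : lam / μ₂ ≤ z) (hz1 : z < 1) : Summable (w lam μ₁ μ₂ z) := by
  obtain ⟨r, hr0, hr1, hr⟩ := exists_w_ratio_bound hlam hstable hμ hz hz1
  exact ((summable_geometric_of_lt_one hr0.le hr1).mul_right (w lam μ₁ μ₂ z 0)).of_nonneg_of_le
    (fun k => (w_pos hlam hstable hμ hz hz1 k).le) fun k => hr 0 k

/-- Balance of the flows up and down between two consecutive levels. It comes from summing all
column equations, which yields the identity multiplied by `1 - z`. -/
theorem tsum_w_balance (hlam : 0 < lam) (hstable : lam < μ₂) (hμ : μ₂ < μ₁)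
    (hz : lam / μ₂ ≤ z) (hz1 : z < 1) :
    μ₁ * ∑' k, w lam μ₁ μ₂ z (k + 1) = μ₂ * z * ∑' k, w lam μ₁ μ₂ z k := by
  have hμ₁ : μ₁ ≠ 0 := ((hlam.trans hstable).trans hμ).ne'
  have hs := summable_w hlam hstable hμ hz hz1
  have hs1 := (summable_nat_add_iff 1).2 hs
  have hs2 := (summable_nat_add_iff 2).2 hs
  have h1 : ∑' k, μ₁ * w lam μ₁ μ₂ z (k + 2)
      = ∑' k, ((lam + μ₁ + μ₂ * (1 - z)) * z * w lam μ₁ μ₂ z (k + 1)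
        - lam * z * w lam μ₁ μ₂ z k) := tsum_congr fun k => mul_w_add_two hμ₁ k
  rw [(hs1.mul_left _).tsum_sub (hs.mul_left _), tsum_mul_left, tsum_mul_left, tsum_mul_left] at h1
  have h2 := hs.tsum_eq_zero_add
  have h3 := hs1.tsum_eq_zero_add
  have h4 : w lam μ₁ μ₂ z 0 = 1 := by rw [w]
  have h5 := mul_w_one (lam := lam) (μ₂ := μ₂) (z := z) hμ₁
  rw [h4] at h2
  simp only [zero_add, add_assoc, one_add_one_eq_two] at h3
  apply mul_left_cancel₀ (sub_pos.2 hz1).ne'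
  linear_combination h1 + μ₁ * h3 + h5 - (lam + μ₂ * (1 - z)) * z * h2

/-- Each step of the recursion removes `(μ₁ - μ₂ z) w (i + 1)` from the product, which is exactly
the first term of the tail; the level balance supplies the start `i = 0`. -/
theorem modifiedRate_mul_w (hlam : 0 < lam) (hstable : lam < μ₂) (hμ : μ₂ < μ₁)
    (hz : lam / μ₂ ≤ z) (hz1 : z < 1) (i : ℕ) :
    modifiedRate lam μ₁ μ₂ z i * w lam μ₁ μ₂ z i
      = (μ₁ - μ₂ * z) * ∑' k, w lam μ₁ μ₂ z (k + (i + 1)) := by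
  have hs := summable_w hlam hstable hμ hz hz1
  induction i with
  | zero =>
    have h1 := tsum_w_balance hlam hstable hμ hz hz1
    have h2 := hs.tsum_eq_zero_add
    have h4 : w lam μ₁ μ₂ z 0 = 1 := by rw [w]
    rw [h4] at h2
    rw [modifiedRate, h4, zero_add]
    linear_combination -h1 - μ₂ * z * h2
  | succ i ih =>
    have h1 := ((summable_nat_add_iff (i + 1)).2 hs).tsum_eq_zero_add
    have h2 := (w_pos hlam hstable hμ hz hz1 (i + 1)).ne'
    simp only [zero_add] at h1
    have h3 : ∀ k, k + 1 + (i + 1) = k + (i + 1 + 1) := fun k => by ring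
    simp only [h3] at h1
    rw [h1] at ih
    have h4 : modifiedRate lam μ₁ μ₂ z (i + 1) * w lam μ₁ μ₂ z (i + 1)
        = modifiedRate lam μ₁ μ₂ z i * w lam μ₁ μ₂ z i + (μ₂ * z - μ₁) * w lam μ₁ μ₂ z (i + 1) := by
      rw [modifiedRate]
      field_simp
      ring
    rw [h4, ih]
    ring

theorem modifiedRate_pos (hlam : 0 < lam) (hstable : lam < μ₂) (hμ : μ₂ < μ₁)
    (hz : lam / μ₂ ≤ z) (hz1 : z < 1) (i : ℕ) : 0 < modifiedRate lam μ₁ μ₂ z i := by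
  have hs := summable_w hlam hstable hμ hz hz1
  have h1 : 0 < ∑' k, w lam μ₁ μ₂ z (k + (i + 1)) :=
    ((summable_nat_add_iff (i + 1)).2 hs).tsum_pos
      (fun k => (w_pos hlam hstable hμ hz hz1 _).le) 0 (w_pos hlam hstable hμ hz hz1 _)
  have h2 : 0 < μ₁ - μ₂ * z := by nlinarith
  have h3 := mul_pos h2 h1
  rw [← modifiedRate_mul_w hlam hstable hμ hz hz1] at h3
  exact pos_of_mul_pos_left h3 (w_pos hlam hstable hμ hz hz1 i).le

theorem exists_modifiedRate_le (hlam : 0 < lam) (hstable : lam < μ₂) (hμ : μ₂ < μ₁)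
    (hz : lam / μ₂ ≤ z) (hz1 : z < 1) : ∃ C, ∀ i, modifiedRate lam μ₁ μ₂ z i ≤ C := by
  obtain ⟨r, hr0, hr1, hr⟩ := exists_w_ratio_bound hlam hstable hμ hz hz1
  have hs := summable_w hlam hstable hμ hz hz1
  have hg := summable_geometric_of_lt_one hr0.le hr1
  refine ⟨(μ₁ - μ₂ * z) * ∑' k, r ^ (k + 1), fun i => ?_⟩
  have hw := w_pos hlam hstable hμ hz hz1 i
  have h2 : 0 ≤ μ₁ - μ₂ * z := by nlinarith
  refine le_of_mul_le_mul_right ?_ hw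
  rw [modifiedRate_mul_w hlam hstable hμ hz hz1, mul_assoc, ← tsum_mul_right]
  refine mul_le_mul_of_nonneg_left ?_ h2
  refine ((summable_nat_add_iff (i + 1)).2 hs).tsum_le_tsum (fun k => ?_)
    (((summable_nat_add_iff 1).2 hg).mul_right _)
  rw [add_comm i 1, ← add_assoc]
  exact hr i (k + 1)

end LevelVector

/-! ### The minimal solution of the rate equation as a monotone limit -/

open scoped ENNReal

/-- The row vector `f` times a matrix that moves the phase up by one at rate `a` and keeps the
phase `0` at rate `b`. -/
def shift {A : Type*} [Mul A] (a b : A) (f : ℕ → A) : ℕ → A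
  | 0 => b * f 0
  | j + 1 => a * f j

theorem shift_mono {a b : ℝ≥0∞} {f g : ℕ → ℝ≥0∞} (h : ∀ j, f j ≤ g j) (j : ℕ) :
    shift a b f j ≤ shift a b g j := by
  cases j <;> exact mul_le_mul_right (h _) _

theorem shift_add (a b : ℝ≥0∞) (f g : ℕ → ℝ≥0∞) (j : ℕ) :
    shift a b (fun j => f j + g j) j = shift a b f j + shift a b g j := by
  cases j <;> exact mul_add _ _ _

theorem tsum_mul_shift (a b : ℝ≥0∞) (v : ℕ → ℝ≥0∞) (R : ℕ → ℕ → ℝ≥0∞) (j : ℕ) :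
    ∑' i, v i * shift a b (R i) j = shift a b (fun j => ∑' i, v i * R i j) j := by
  cases j <;> simp only [shift, mul_left_comm _ a, mul_left_comm _ b, ENNReal.tsum_mul_left]

theorem tsum_shift (a b : ℝ≥0∞) (f : ℕ → ℝ≥0∞) :
    ∑' j, shift a b f j = b * f 0 + a * ∑' j, f j := by
  rw [tsum_eq_zero_add' ENNReal.summable]
  simp only [shift, ENNReal.tsum_mul_left]

/-- One step of the fixed point iteration for the rate matrix of the tandem queue. -/
noncomputable def rateStep {A : Type*} [NonUnitalNonAssocSemiring A] [TopologicalSpace A] (a b d : A)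
    (R : ℕ → ℕ → A) : ℕ → ℕ → A := fun i j =>
  (if i = j + 1 then b else 0) + shift a b (R i) j + d * ∑' k, R i k * R k j

section Iteration

variable {a b d : ℝ≥0∞}

theorem rateStep_mono {R R' : ℕ → ℕ → ℝ≥0∞} (h : ∀ i j, R i j ≤ R' i j) (i j : ℕ) :
    rateStep a b d R i j ≤ rateStep a b d R' i j :=
  add_le_add (add_le_add le_rfl (shift_mono (h i) j))
    (mul_le_mul_right (ENNReal.tsum_le_tsum fun k => mul_le_mul' (h i k) (h k j)) _)

/-- The iterates of `rateStep` started from the zero matrix. -/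
noncomputable def rateIter (a b d : ℝ≥0∞) : ℕ → ℕ → ℕ → ℝ≥0∞
  | 0 => fun _ _ => 0
  | n + 1 => rateStep a b d (rateIter a b d n)

theorem rateIter_le_succ (n i j : ℕ) : rateIter a b d n i j ≤ rateIter a b d (n + 1) i j := by
  induction n generalizing i j with
  | zero => exact zero_le
  | succ n ih => exact rateStep_mono ih i j

theorem rateIter_monotone (i j : ℕ) : Monotone fun n => rateIter a b d n i j :=
  monotone_nat_of_le_succ fun n => rateIter_le_succ n i j

/-- The limit of the iterates of `rateStep`. -/
noncomputable def rateLimit (a b d : ℝ≥0∞) : ℕ → ℕ → ℝ≥0∞ := fun i j => ⨆ n, rateIter a b d n i j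

theorem tsum_iSup_of_monotone {f : ℕ → ℕ → ℝ≥0∞} (hf : ∀ k, Monotone fun n => f n k) :
    ∑' k, ⨆ n, f n k = ⨆ n, ∑' k, f n k := by
  simp_rw [← MeasureTheory.lintegral_count]
  exact MeasureTheory.lintegral_iSup (fun n => measurable_of_countable _)
    fun m n hmn k => hf k hmn

theorem tsum_row_mul_rateStep (v : ℕ → ℝ≥0∞) (R : ℕ → ℕ → ℝ≥0∞) (j : ℕ) :
    ∑' i, v i * rateStep a b d R i j = b * v (j + 1) + shift a b (fun j => ∑' i, v i * R i j) j
      + d * ∑' k, (∑' i, v i * R i k) * R k j := by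
  simp only [rateStep, mul_add, ENNReal.tsum_add]
  congr 1
  · congr 1
    · rw [tsum_eq_single (j + 1) fun i hi => by simp [hi]]
      simp [mul_comm]
    · exact tsum_mul_shift a b v R j
  · simp only [mul_left_comm _ d, ENNReal.tsum_mul_left, ← ENNReal.tsum_mul_right]
    rw [ENNReal.tsum_comm]
    simp only [← ENNReal.tsum_mul_left, mul_assoc]

/-- Row `0` of `R` vanishes, so `v 0` does not contribute. This saving matters: the missing `b * v
0` is what `shift` retains at phase `0`, so the two together have mass at most `(a + b) ∑ v`. -/
theorem mul_tsum_tsum_mul_le {C : ℝ≥0∞} (hC : d * C = b) {R : ℕ → ℕ → ℝ≥0∞}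
    (hR : ∀ i, ∑' j, R i j ≤ if i = 0 then 0 else C) (v : ℕ → ℝ≥0∞) :
    d * ∑' j, ∑' k, v k * R k j ≤ b * ∑' k, v (k + 1) := by
  rw [ENNReal.tsum_comm]
  simp only [ENNReal.tsum_mul_left]
  have h0 : ∑' j, R 0 j = 0 := le_antisymm (by simpa using hR 0) zero_le
  rw [tsum_eq_zero_add' ENNReal.summable, h0, mul_zero, zero_add, ← hC, mul_assoc]
  refine mul_le_mul_right ?_ d
  rw [← ENNReal.tsum_mul_left]
  refine ENNReal.tsum_le_tsum fun k => ?_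
  rw [mul_comm]
  exact mul_le_mul_left (by simpa using hR (k + 1)) _

/-- The constant `C = b / d` is reproduced by a step, since `b + (a + b) C = (a + b + d) C = C`. Row
`0` stays zero because the upward jump needs a customer in the first queue. -/
theorem rateIter_row_sum_le {C : ℝ≥0∞} (hC : d * C = b) (hsum : a + b + d = 1) (n i : ℕ) :
    ∑' j, rateIter a b d n i j ≤ if i = 0 then 0 else C := by
  induction n generalizing i with
  | zero => simp [rateIter]
  | succ n ih =>
    set R := rateIter a b d n with hR
    have h1 : ∑' j, (if i = j + 1 then b else 0) = if i = 0 then 0 else b := by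
      cases i with
      | zero => simp
      | succ i =>
        rw [tsum_eq_single i fun j hj => by simp [hj.symm]]
        simp
    have h2 := mul_tsum_tsum_mul_le hC ih (R i)
    have h4 : R i 0 + ∑' k, R i (k + 1) = ∑' k, R i k :=
      (tsum_eq_zero_add' ENNReal.summable).symm
    calc ∑' j, rateStep a b d R i j
        = (if i = 0 then 0 else b) + (b * R i 0 + a * ∑' j, R i j)
          + d * ∑' j, ∑' k, R i k * R k j := by
          simp only [rateStep, ENNReal.tsum_add, tsum_shift, h1, ENNReal.tsum_mul_left]
      _ ≤ (if i = 0 then 0 else b) + (b * R i 0 + a * ∑' j, R i j) + b * ∑' k, R i (k + 1) := by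
          gcongr
      _ = (if i = 0 then 0 else b) + (a + b) * ∑' j, R i j := by
          rw [← h4]
          ring
      _ ≤ (if i = 0 then 0 else b) + (a + b) * if i = 0 then 0 else C := by
          gcongr
          exact ih i
      _ = if i = 0 then 0 else C := by
          split_ifs
          · simp
          · calc b + (a + b) * C = (a + b + d) * C := by rw [add_mul _ d, hC, add_comm]
              _ = C := by rw [hsum, one_mul]

/-- The hypothesis says that `W` solves the equation obtained by replacing right multiplication by
`R` with the scalar `ζ`, so one step of the iteration preserves the inequality. -/
theorem tsum_mul_rateIter_le {W : ℕ → ℝ≥0∞} {ζ : ℝ≥0∞}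
    (hW : ∀ j, ζ * W j = b * W (j + 1) + shift a b (fun j => ζ * W j) j + d * (ζ * (ζ * W j)))
    (n j : ℕ) : ∑' i, W i * rateIter a b d n i j ≤ ζ * W j := by
  induction n generalizing j with
  | zero => simp [rateIter]
  | succ n ih =>
    rw [rateIter, tsum_row_mul_rateStep, hW j]
    refine add_le_add (add_le_add le_rfl (shift_mono ih j)) (mul_le_mul_right ?_ d)
    calc ∑' k, (∑' i, W i * rateIter a b d n i k) * rateIter a b d n k j
        ≤ ∑' k, ζ * W k * rateIter a b d n k j :=
          ENNReal.tsum_le_tsum fun k => mul_le_mul_left (ih k) _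
      _ = ζ * ∑' k, W k * rateIter a b d n k j := by
          simp only [mul_assoc, ENNReal.tsum_mul_left]
      _ ≤ ζ * (ζ * W j) := mul_le_mul_right (ih j) ζ

theorem rateLimit_row_sum_le {C : ℝ≥0∞} (hC : d * C = b) (hsum : a + b + d = 1) (i : ℕ) :
    ∑' j, rateLimit a b d i j ≤ if i = 0 then 0 else C := by
  simp only [rateLimit]
  rw [tsum_iSup_of_monotone fun j => rateIter_monotone i j]
  exact iSup_le fun n => rateIter_row_sum_le hC hsum n i

theorem tsum_mul_rateLimit_le {W : ℕ → ℝ≥0∞} {ζ : ℝ≥0∞}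
    (hW : ∀ j, ζ * W j = b * W (j + 1) + shift a b (fun j => ζ * W j) j + d * (ζ * (ζ * W j)))
    (j : ℕ) : ∑' i, W i * rateLimit a b d i j ≤ ζ * W j := by
  simp only [rateLimit, ENNReal.mul_iSup]
  exact (tsum_iSup_of_monotone (f := fun n i => W i * rateIter a b d n i j)
    fun i m n hmn => mul_le_mul_right (rateIter_monotone i j hmn) _).trans_le
      (iSup_le fun n => tsum_mul_rateIter_le hW n j)

theorem rateLimit_le {R : ℕ → ℕ → ℝ≥0∞} (hR : ∀ i j, rateStep a b d R i j ≤ R i j) (i j : ℕ) :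
    rateLimit a b d i j ≤ R i j := by
  refine iSup_le fun n => ?_
  induction n generalizing i j with
  | zero => exact zero_le
  | succ n ih => exact (rateStep_mono ih i j).trans (hR i j)

theorem tsum_rateLimit_mul (i j : ℕ) :
    ∑' k, rateLimit a b d i k * rateLimit a b d k j
      = ⨆ n, ∑' k, rateIter a b d n i k * rateIter a b d n k j := by
  rw [← tsum_iSup_of_monotone fun k m n hmn =>
    mul_le_mul' (rateIter_monotone i k hmn) (rateIter_monotone k j hmn)]
  refine tsum_congr fun k => le_antisymm ?_ (iSup_le fun n => ?_)
  · simp only [rateLimit, ENNReal.iSup_mul, ENNReal.mul_iSup]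
    refine iSup_le fun m => iSup_le fun n => le_iSup_of_le (max m n) ?_
    exact mul_le_mul' (rateIter_monotone _ _ (by simp)) (rateIter_monotone _ _ (by simp))
  · exact mul_le_mul' (le_iSup (fun n => rateIter a b d n i k) n)
      (le_iSup (fun n => rateIter a b d n k j) n)

theorem shift_rateLimit (i j : ℕ) :
    shift a b (rateLimit a b d i) j = ⨆ n, shift a b (rateIter a b d n i) j := by
  cases j <;> simp only [shift, rateLimit, ENNReal.mul_iSup]

theorem rateStep_rateLimit (i j : ℕ) :
    rateStep a b d (rateLimit a b d) i j = rateLimit a b d i j := by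
  apply le_antisymm
  · have h1 : (if i = j + 1 then b else 0) + ⨆ n, shift a b (rateIter a b d n i) j
        = ⨆ n, ((if i = j + 1 then b else 0) + shift a b (rateIter a b d n i) j) :=
      ENNReal.add_iSup _
    rw [rateStep, tsum_rateLimit_mul, shift_rateLimit, ENNReal.mul_iSup, h1,
      ENNReal.iSup_add_iSup_of_monotone]
    · exact iSup_le fun n => le_iSup (fun n => rateIter a b d n i j) (n + 1)
    · intro m n hmn
      exact add_le_add le_rfl (shift_mono (fun k => rateIter_monotone i k hmn) j)
    · intro m n hmn
      exact mul_le_mul_right (ENNReal.tsum_le_tsum fun k =>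
        mul_le_mul' (rateIter_monotone i k hmn) (rateIter_monotone k j hmn)) _
  · refine iSup_le fun n => (rateIter_le_succ n i j).trans ?_
    exact rateStep_mono (fun i j => le_iSup (fun n => rateIter a b d n i j) n) i j

/-- A summable positive solution of `W (Q₀ + ζ Q₁ + ζ² Q₂) = 0` with `ζ < 1` is an eigenvector of
the rate matrix. -/
theorem tsum_mul_rateLimit_eq {C : ℝ≥0∞} (hC : d * C = b) (hsum : a + b + d = 1) (hd : d ≠ 0)
    {W : ℕ → ℝ≥0∞} {ζ : ℝ≥0∞} (hζ : ζ < 1) (hWs : ∑' j, W j ≠ ⊤)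
    (hW : ∀ j, ζ * W j = b * W (j + 1) + shift a b (fun j => ζ * W j) j + d * (ζ * (ζ * W j)))
    (j : ℕ) : ∑' i, W i * rateLimit a b d i j = ζ * W j := by
  set R := rateLimit a b d with hR
  set u : ℕ → ℝ≥0∞ := fun j => ∑' i, W i * R i j with hu
  have hle : ∀ j, u j ≤ ζ * W j := tsum_mul_rateLimit_le hW
  -- The deficit; the truncated subtraction is genuine because `u ≤ ζ W`.
  set v : ℕ → ℝ≥0∞ := fun j => ζ * W j - u j with hv
  have huv : ∀ j, ζ * W j = u j + v j := fun j => (add_tsub_cancel_of_le (hle j)).symm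
  have hζW : ∑' j, ζ * W j ≠ ⊤ := by
    rw [ENNReal.tsum_mul_left]
    exact ENNReal.mul_ne_top (hζ.trans ENNReal.one_lt_top).ne hWs
  have hufin : ∀ j, u j ≠ ⊤ := fun j =>
    ne_top_of_le_ne_top (ENNReal.ne_top_of_tsum_ne_top hζW j) (hle j)
  have hu_eq : ∀ j, u j = b * W (j + 1) + shift a b u j + d * ∑' k, u k * R k j := fun j => by
    conv_lhs => rw [hu]
    rw [← tsum_row_mul_rateStep]
    simp only [hR, rateStep_rateLimit]
  have hRζ : ∀ j, ζ * u j = ∑' k, u k * R k j + ∑' k, v k * R k j := fun j => by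
    rw [← ENNReal.tsum_add]
    simp only [← add_mul, ← huv, mul_assoc, ENNReal.tsum_mul_left]
    rfl
  -- The difference of the equations for `ζ W` and `u`, using `ζ (ζ W) - u R = ζ v + v R`; the
  -- finite `u j` is cancelled.
  have hv_eq : ∀ j, v j = shift a b v j + d * ∑' k, v k * R k j + d * (ζ * v j) := fun j => by
    apply (ENNReal.add_right_inj (hufin j)).1
    rw [← huv, hW j]
    simp only [huv]
    rw [shift_add, mul_add ζ, hRζ]
    conv_rhs => rw [hu_eq j]
    ring
  have hV : ∑' j, v j ≤ (a + b + d * ζ) * ∑' j, v j := by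
    have h1 := mul_tsum_tsum_mul_le hC (rateLimit_row_sum_le hC hsum) v
    have h4 : v 0 + ∑' k, v (k + 1) = ∑' k, v k := (tsum_eq_zero_add' ENNReal.summable).symm
    calc ∑' j, v j = b * v 0 + a * ∑' j, v j + d * ∑' j, ∑' k, v k * R k j
          + d * (ζ * ∑' j, v j) := by
          conv_lhs => rw [tsum_congr hv_eq]
          simp only [ENNReal.tsum_add, tsum_shift, ENNReal.tsum_mul_left]
      _ ≤ b * v 0 + a * ∑' j, v j + b * ∑' k, v (k + 1) + d * (ζ * ∑' j, v j) := by gcongr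
      _ = (a + b + d * ζ) * ∑' j, v j := by
          rw [← h4]
          ring
  have hVfin : ∑' j, v j ≠ ⊤ :=
    ne_top_of_le_ne_top hζW (ENNReal.tsum_le_tsum fun j => tsub_le_self)
  have hdfin : d ≠ ⊤ := by
    refine ne_top_of_le_ne_top ENNReal.one_ne_top (hsum ▸ le_add_self)
  -- The only place where `ζ < 1` gives a strict loss of mass; with `∑ v` finite it forces `∑ v =
  -- 0`.
  have hθ : a + b + d * ζ < 1 := by
    rw [← hsum]
    refine ENNReal.add_lt_add_left ?_ ?_
    · exact ne_top_of_le_ne_top ENNReal.one_ne_top (hsum ▸ le_self_add)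
    · simpa using ENNReal.mul_lt_mul_right hd hdfin hζ
  have hV0 : ∑' j, v j = 0 := by
    by_contra h0
    have h1 := ENNReal.div_le_of_le_mul hV
    rw [ENNReal.div_self h0 hVfin] at h1
    exact absurd hθ (not_lt.2 h1)
  change u j = ζ * W j
  rw [huv j, ENNReal.tsum_eq_zero.1 hV0 j, add_zero]

end Iteration

/-! ### The rate matrix of the tandem queue over the reals -/

section RateMatrix

variable {lam μ₁ μ₂ : ℝ}

theorem tsum_mul_blockLocal (f : ℕ → ℝ) (j : ℕ) :
    ∑' k, f k * blockLocal lam μ₁ μ₂ k j = shift lam μ₁ f j - (lam + μ₁ + μ₂) * f j := by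
  cases j with
  | zero =>
    rw [tsum_eq_single 0 fun k hk => by simp [blockLocal, Ne.symm hk]]
    simp [blockLocal, shift]
    ring
  | succ j =>
    rw [tsum_eq_sum (s := {j, j + 1})]
    · rw [Finset.sum_pair (by simp)]
      simp [blockLocal, shift]
      ring
    · intro k hk
      simp only [Finset.mem_insert, Finset.mem_singleton, not_or] at hk
      simp [blockLocal, Ne.symm hk.1, Ne.symm hk.2]

theorem tsum_mul_blockDown (f : ℕ → ℝ) (j : ℕ) :
    ∑' k, f k * blockDown μ₂ k j = μ₂ * f j := by
  rw [tsum_eq_single j fun k hk => by simp [blockDown, hk]]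
  simp [blockDown, mul_comm]

theorem rateStep_div (M : ℝ) (R : Matrix ℕ ℕ ℝ) (i j : ℕ) :
    rateStep (lam / M) (μ₁ / M) (μ₂ / M) R i j
      = (blockUp μ₁ i j + shift lam μ₁ (R i) j + μ₂ * ∑' k, R i k * R k j) / M := by
  unfold rateStep blockUp
  cases j <;> split_ifs <;> simp only [shift] <;> ring

/-- Uniformization: adding `M R` with `M = lam + μ₁ + μ₂` and dividing by `M` gives a fixed point
equation with nonnegative coefficients. The diagonal of `Q₁ + M` is zero except for `μ₁` at phase
`0`, where the first server idles; this is the exceptional value in `shift`. -/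
theorem mem_rateEquationSolutions_iff (hM : lam + μ₁ + μ₂ ≠ 0) (R : Matrix ℕ ℕ ℝ) :
    R ∈ rateEquationSolutions (blockUp μ₁) (blockLocal lam μ₁ μ₂) (blockDown μ₂) ↔
      (∀ i j, 0 ≤ R i j) ∧ (∀ i j, Summable fun k => R i k * R k j) ∧
        ∀ i j, rateStep (lam / (lam + μ₁ + μ₂)) (μ₁ / (lam + μ₁ + μ₂)) (μ₂ / (lam + μ₁ + μ₂)) R i j
          = R i j := by
  rw [rateEquationSolutions, Set.mem_ofPred_eq]
  refine and_congr_right fun _ => and_congr_right fun _ => forall_congr' fun i =>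
    forall_congr' fun j => ?_
  rw [tsum_mul_blockLocal, tsum_mul_blockDown, rateStep_div, div_eq_iff hM]
  constructor <;> intro h <;> linarith

theorem ofReal_rateStep {a b d : ℝ} (ha : 0 ≤ a) (hb : 0 ≤ b) (hd : 0 ≤ d) {R : Matrix ℕ ℕ ℝ}
    (hR : ∀ i j, 0 ≤ R i j) (hs : ∀ i j, Summable fun k => R i k * R k j) (i j : ℕ) :
    ENNReal.ofReal (rateStep a b d R i j) = rateStep (ENNReal.ofReal a) (ENNReal.ofReal b)
      (ENNReal.ofReal d) (fun i j => ENNReal.ofReal (R i j)) i j := by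
  have h1 : 0 ≤ if i = j + 1 then b else 0 := by split_ifs <;> simp [hb]
  have h2 : 0 ≤ shift a b (R i) j := by
    cases j
    · exact mul_nonneg hb (hR _ _)
    · exact mul_nonneg ha (hR _ _)
  have h3 : 0 ≤ ∑' k, R i k * R k j := tsum_nonneg fun k => mul_nonneg (hR i k) (hR k j)
  unfold rateStep
  rw [ENNReal.ofReal_add (add_nonneg h1 h2) (mul_nonneg hd h3),
    ENNReal.ofReal_add h1 h2, ENNReal.ofReal_mul hd,
    ENNReal.ofReal_tsum_of_nonneg (fun k => mul_nonneg (hR i k) (hR k j)) (hs i j)]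
  congr 1
  · congr 1
    · split_ifs <;> simp
    · cases j
      · exact ENNReal.ofReal_mul hb
      · exact ENNReal.ofReal_mul ha
  · simp only [ENNReal.ofReal_mul (hR i _)]

theorem rateStep_nonneg {a b d : ℝ} (ha : 0 ≤ a) (hb : 0 ≤ b) (hd : 0 ≤ d) {R : Matrix ℕ ℕ ℝ}
    (hR : ∀ i j, 0 ≤ R i j) (i j : ℕ) : 0 ≤ rateStep a b d R i j := by
  refine add_nonneg (add_nonneg ?_ ?_)
    (mul_nonneg hd (tsum_nonneg fun k => mul_nonneg (hR i k) (hR k j)))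
  · split_ifs <;> simp [hb]
  · cases j
    · exact mul_nonneg hb (hR _ _)
    · exact mul_nonneg ha (hR _ _)

theorem ofReal_w_equation {z : ℝ} (hlam : 0 < lam) (hstable : lam < μ₂) (hμ : μ₂ < μ₁)
    (hz : lam / μ₂ ≤ z) (hz1 : z < 1) (j : ℕ) :
    ENNReal.ofReal z * ENNReal.ofReal (w lam μ₁ μ₂ z j)
      = ENNReal.ofReal (μ₁ / (lam + μ₁ + μ₂)) * ENNReal.ofReal (w lam μ₁ μ₂ z (j + 1))
        + shift (ENNReal.ofReal (lam / (lam + μ₁ + μ₂))) (ENNReal.ofReal (μ₁ / (lam + μ₁ + μ₂)))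
          (fun j => ENNReal.ofReal z * ENNReal.ofReal (w lam μ₁ μ₂ z j)) j
        + ENNReal.ofReal (μ₂ / (lam + μ₁ + μ₂))
          * (ENNReal.ofReal z * (ENNReal.ofReal z * ENNReal.ofReal (w lam μ₁ μ₂ z j))) := by
  have hμ₂ : 0 < μ₂ := hlam.trans hstable
  have hμ₁ : 0 < μ₁ := hμ₂.trans hμ
  have hz0 : 0 < z := (div_pos hlam hμ₂).trans_le hz
  have hw : ∀ k, 0 ≤ w lam μ₁ μ₂ z k := fun k => (w_pos hlam hstable hμ hz hz1 k).le
  have ha : 0 ≤ lam / (lam + μ₁ + μ₂) := by positivity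
  have hb : 0 ≤ μ₁ / (lam + μ₁ + μ₂) := by positivity
  have hd : 0 ≤ μ₂ / (lam + μ₁ + μ₂) := by positivity
  have hj := hw j
  have hj1 := hw (j + 1)
  simp only [← ENNReal.ofReal_mul hz0.le, ← ENNReal.ofReal_mul hb, ← ENNReal.ofReal_mul hd]
  cases j with
  | zero =>
    have h1 := mul_w_one (lam := lam) (μ₂ := μ₂) (z := z) hμ₁.ne'
    have h0 : w lam μ₁ μ₂ z 0 = 1 := by rw [w]
    rw [shift, ← ENNReal.ofReal_mul hb, ← ENNReal.ofReal_add (by positivity) (by positivity),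
      ← ENNReal.ofReal_add (by positivity) (by positivity), h0]
    congr 1
    rw [zero_add]
    field_simp
    linear_combination -h1
  | succ j =>
    have h1 := mul_w_add_two (lam := lam) (μ₂ := μ₂) (z := z) hμ₁.ne' j
    have hj0 := hw j
    rw [shift, ← ENNReal.ofReal_mul ha, ← ENNReal.ofReal_add (by positivity) (by positivity),
      ← ENNReal.ofReal_add (by positivity) (by positivity)]
    congr 1
    field_simp
    linear_combination -h1

theorem exists_isRateMatrix {z : ℝ} (hlam : 0 < lam) (hstable : lam < μ₂) (hμ : μ₂ < μ₁)
    (hz : lam / μ₂ ≤ z) (hz1 : z < 1) :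
    ∃ R, IsRateMatrix (blockUp μ₁) (blockLocal lam μ₁ μ₂) (blockDown μ₂) R ∧
      ∀ j, HasSum (fun i => w lam μ₁ μ₂ z i * R i j) (z * w lam μ₁ μ₂ z j) := by
  have hμ₂ : 0 < μ₂ := hlam.trans hstable
  have hμ₁ : 0 < μ₁ := hμ₂.trans hμ
  have hz0 : 0 < z := (div_pos hlam hμ₂).trans_le hz
  set M := lam + μ₁ + μ₂ with hMdef
  have hM : 0 < M := by positivity
  have ha : 0 ≤ lam / M := by positivity
  have hb : 0 ≤ μ₁ / M := by positivity
  have hd : 0 < μ₂ / M := by positivity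
  set a := ENNReal.ofReal (lam / M)
  set b := ENNReal.ofReal (μ₁ / M)
  set d := ENNReal.ofReal (μ₂ / M)
  have hC : d * ENNReal.ofReal (μ₁ / μ₂) = b := by
    rw [← ENNReal.ofReal_mul hd.le]
    congr 1
    field_simp
  have hsum : a + b + d = 1 := by
    rw [← ENNReal.ofReal_add ha hb, ← ENNReal.ofReal_add (add_nonneg ha hb) hd.le,
      ← ENNReal.ofReal_one]
    congr 1
    rw [← add_div, ← add_div, ← hMdef, div_self hM.ne']
  have hw : ∀ k, 0 ≤ w lam μ₁ μ₂ z k := fun k => (w_pos hlam hstable hμ hz hz1 k).le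
  have hws := summable_w hlam hstable hμ hz hz1
  have hrow : ∀ i, ∑' j, rateLimit a b d i j ≤ ENNReal.ofReal (μ₁ / μ₂) := fun i =>
    (rateLimit_row_sum_le hC hsum i).trans (by split_ifs <;> simp)
  have hfin : ∀ i j, rateLimit a b d i j ≠ ⊤ := fun i =>
    ENNReal.ne_top_of_tsum_ne_top (ne_top_of_le_ne_top ENNReal.ofReal_ne_top (hrow i))
  set R : Matrix ℕ ℕ ℝ := fun i j => (rateLimit a b d i j).toReal with hR
  have hRof : (fun i j => ENNReal.ofReal (R i j)) = rateLimit a b d :=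
    funext fun i => funext fun j => ENNReal.ofReal_toReal (hfin i j)
  have hR0 : ∀ i j, 0 ≤ R i j := fun i j => ENNReal.toReal_nonneg
  -- Entries are at most the row sum bound `μ₁ / μ₂`, so row `i` dominates the series.
  have hRs : ∀ i j, Summable fun k => R i k * R k j := fun i j => by
    simp only [hR, ← ENNReal.toReal_mul]
    refine ENNReal.summable_toReal (ne_top_of_le_ne_top (b := (∑' k, rateLimit a b d i k)
      * ENNReal.ofReal (μ₁ / μ₂)) ?_ ?_)
    · exact ENNReal.mul_ne_top (ne_top_of_le_ne_top ENNReal.ofReal_ne_top (hrow i))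
        ENNReal.ofReal_ne_top
    · rw [← ENNReal.tsum_mul_right]
      exact ENNReal.tsum_le_tsum fun k =>
        mul_le_mul_right ((ENNReal.le_tsum j).trans (hrow k)) _
  refine ⟨R, ⟨(mem_rateEquationSolutions_iff hM.ne' R).2 ⟨hR0, hRs, fun i j => ?_⟩,
    fun R' hR' i j => ?_⟩, fun j => ?_⟩
  · rw [← ENNReal.ofReal_eq_ofReal_iff (rateStep_nonneg ha hb hd.le hR0 i j) (hR0 i j),
      ofReal_rateStep ha hb hd.le hR0 hRs, hRof, rateStep_rateLimit]
    exact (congrFun (congrFun hRof i) j).symm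
  · obtain ⟨h1, h2, h3⟩ := (mem_rateEquationSolutions_iff hM.ne' R').1 hR'
    refine ENNReal.toReal_le_of_le_ofReal (h1 i j) ?_
    refine rateLimit_le (R := fun i j => ENNReal.ofReal (R' i j)) (fun i j => ?_) i j
    rw [← ofReal_rateStep ha hb hd.le h1 h2, h3]
  · have hζ : ENNReal.ofReal z < 1 := by
      rw [← ENNReal.ofReal_one]
      exact (ENNReal.ofReal_lt_ofReal_iff one_pos).2 hz1
    have key := tsum_mul_rateLimit_eq hC hsum (ENNReal.ofReal_pos.2 hd).ne'
      (W := fun j => ENNReal.ofReal (w lam μ₁ μ₂ z j)) hζ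
      (by rw [← ENNReal.ofReal_tsum_of_nonneg hw hws]; exact ENNReal.ofReal_ne_top)
      (ofReal_w_equation hlam hstable hμ hz hz1) j
    have hne : ∑' i, ENNReal.ofReal (w lam μ₁ μ₂ z i) * rateLimit a b d i j ≠ ⊤ := by
      rw [key]
      exact ENNReal.mul_ne_top ENNReal.ofReal_ne_top ENNReal.ofReal_ne_top
    have h1 := ENNReal.hasSum_toReal hne
    rw [← ENNReal.tsum_toReal_eq (ENNReal.ne_top_of_tsum_ne_top hne), key, ENNReal.toReal_mul,
      ENNReal.toReal_ofReal hz0.le, ENNReal.toReal_ofReal (hw j)] at h1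
    simpa only [ENNReal.toReal_mul, ENNReal.toReal_ofReal (hw _)] using h1

end RateMatrix

/-! ### The space `ℓ¹` and operators given by their rows -/

section SummableSequences

variable {S : Type*}

/-- The space `ℓ¹(S)`. -/
abbrev Ell1 (S : Type*) := lp (fun _ : S => ℝ) 1

theorem Ell1.summable_norm (f : Ell1 S) : Summable fun x => ‖f x‖ := by
  simpa using (lp.hasSum_norm (p := 1) (by simp) f).summable

theorem Ell1.norm_eq (f : Ell1 S) : ‖f‖ = ∑' x, ‖f x‖ := by
  simpa using lp.norm_eq_tsum_rpow (p := 1) (by simp) f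

/-- A summable function as an element of `ℓ¹`. -/
def Ell1.ofSummable (f : S → ℝ) (hf : Summable f) : Ell1 S :=
  ⟨f, (memℓp_gen (by simpa using hf.norm) : Memℓp f 1)⟩

@[simp]
theorem Ell1.ofSummable_apply (f : S → ℝ) (hf : Summable f) (x : S) :
    Ell1.ofSummable f hf x = f x := rfl

/-- Evaluation at `y` as a bounded functional on `ℓ¹`. -/
noncomputable def Ell1.eval (y : S) : Ell1 S →L[ℝ] ℝ := lp.evalCLM ℝ (fun _ : S => ℝ) 1 y

@[simp]
theorem Ell1.eval_apply (f : Ell1 S) (y : S) : Ell1.eval y f = f y := rfl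

theorem Ell1.summable_smul_of_bound {r : S → Ell1 S} {C : ℝ} (hr : ∀ x, ‖r x‖ ≤ C) (f : Ell1 S) :
    Summable fun x => f x • r x := by
  refine Summable.of_norm_bounded ((Ell1.summable_norm f).mul_right C) fun x => ?_
  rw [norm_smul]
  exact mul_le_mul_of_nonneg_left (hr x) (norm_nonneg _)

/-- The bounded operator on `ℓ¹` that sends the unit vector at `x` to `r x`. -/
noncomputable def Ell1.lift (r : S → Ell1 S) (C : ℝ) (hr : ∀ x, ‖r x‖ ≤ C) :
    Ell1 S →L[ℝ] Ell1 S :=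
  LinearMap.mkContinuous
    { toFun := fun f => ∑' x, f x • r x
      map_add' := fun f g => by
        simp only [lp.coeFn_add, Pi.add_apply, add_smul]
        exact (summable_smul_of_bound hr f).tsum_add (summable_smul_of_bound hr g)
      map_smul' := fun a f => by
        simp only [lp.coeFn_smul, Pi.smul_apply, smul_assoc, RingHom.id_apply]
        exact (summable_smul_of_bound hr f).tsum_const_smul a }
    C fun f => by
      have h := (Ell1.summable_norm f).mul_right C
      have h1 : ∀ x, ‖f x • r x‖ ≤ ‖f x‖ * C := fun x => by
        rw [norm_smul]
        exact mul_le_mul_of_nonneg_left (hr x) (norm_nonneg _)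
      calc ‖∑' x, f x • r x‖ ≤ ∑' x, ‖f x‖ * C := tsum_of_norm_bounded h.hasSum h1
        _ = C * ‖f‖ := by rw [tsum_mul_right, Ell1.norm_eq, mul_comm]

theorem Ell1.hasSum_lift {r : S → Ell1 S} {C : ℝ} (hr : ∀ x, ‖r x‖ ≤ C) (f : Ell1 S) (y : S) :
    HasSum (fun x => f x * r x y) (Ell1.lift r C hr f y) :=
  (summable_smul_of_bound hr f).hasSum.map (Ell1.eval y) (Ell1.eval y).continuous

/-- Summation as a bounded functional on `ℓ¹`. -/
noncomputable def Ell1.total : Ell1 S →L[ℝ] ℝ :=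
  LinearMap.mkContinuous
    { toFun := fun f => ∑' x, f x
      map_add' := fun f g => by
        simp only [lp.coeFn_add, Pi.add_apply]
        exact (Ell1.summable_norm f).of_norm.tsum_add (Ell1.summable_norm g).of_norm
      map_smul' := fun a f => by
        simp only [lp.coeFn_smul, Pi.smul_apply, RingHom.id_apply, smul_eq_mul]
        exact tsum_mul_left }
    1 fun f => by
      rw [one_mul, Ell1.norm_eq]
      exact norm_tsum_le_tsum_norm (Ell1.summable_norm f)

theorem Ell1.hasSum_total (f : Ell1 S) : HasSum f (Ell1.total f) :=
  (Ell1.summable_norm f).of_norm.hasSum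

variable [DecidableEq S]

/-- The unit vector at `x` in `ℓ¹`. -/
noncomputable def Ell1.unit (x : S) : Ell1 S := lp.single 1 x 1

theorem Ell1.unit_apply (x y : S) : Ell1.unit x y = (1 : Matrix S S ℝ) x y := by
  rw [Ell1.unit, lp.single_apply, Matrix.one_apply, Pi.single_apply]
  simp only [eq_comm]

theorem Ell1.hasSum_unit (f : Ell1 S) : HasSum (fun x => f x • Ell1.unit x) f := by
  have h := lp.hasSum_single (p := 1) (by simp) f
  refine h.congr_fun ?_ |> fun h => h
  intro x
  rw [Ell1.unit, ← lp.single_smul]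
  simp

theorem Ell1.lift_unit {r : S → Ell1 S} {C : ℝ} (hr : ∀ x, ‖r x‖ ≤ C) (x : S) :
    Ell1.lift r C hr (Ell1.unit x) = r x := by
  ext y
  refine (Ell1.hasSum_lift hr _ y).unique ?_
  convert hasSum_single x ?_ using 1
  · simp [Ell1.unit_apply]
  · intro k hk
    simp [Ell1.unit_apply, hk.symm]

end SummableSequences

/-! ### Exponentials of bounded operators: fixed vectors and invariant functionals -/

section Exponential

variable {E F : Type*} [NormedAddCommGroup E] [NormedSpace ℝ E] [CompleteSpace E]
  [NormedAddCommGroup F] [NormedSpace ℝ F]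

theorem hasSum_exp_apply (A : E →L[ℝ] E) (f : E) :
    HasSum (fun n : ℕ => ((n.factorial : ℝ)⁻¹) • (A ^ n) f) (NormedSpace.exp A f) :=
  (NormedSpace.exp_series_hasSum_exp' (𝕂 := ℝ) A).map (ContinuousLinearMap.apply ℝ E f)
    (ContinuousLinearMap.apply ℝ E f).continuous

theorem exp_apply_eq_self {A : E →L[ℝ] E} {f : E} (hf : A f = 0) : NormedSpace.exp A f = f := by
  refine (hasSum_exp_apply A f).unique ?_
  convert hasSum_single 0 ?_ using 1
  · simp
  · intro n hn
    obtain ⟨m, rfl⟩ := Nat.exists_eq_succ_of_ne_zero hn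
    simp [pow_succ, hf]

theorem map_exp_apply_eq {A : E →L[ℝ] E} {L : E →L[ℝ] F} (hL : ∀ f, L (A f) = 0) (f : E) :
    L (NormedSpace.exp A f) = L f := by
  refine ((hasSum_exp_apply A f).map L L.continuous).unique ?_
  convert hasSum_single 0 ?_ using 1
  · simp
  · intro n hn
    obtain ⟨m, rfl⟩ := Nat.exists_eq_succ_of_ne_zero hn
    rw [Function.comp_apply, map_smul, pow_succ', mul_apply_eq_comp, hL, smul_zero]

end Exponential

/-! ### Existence of the transition function of a bounded rate matrix -/

section Existence

variable {S : Type*}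

/-- A conservative rate matrix with diagonal bounded below by `-q` and finite rows, the row of `x`
being supported in `F x`. -/
structure IsBoundedRateMatrix (Q : Matrix S S ℝ) (q : ℝ) (F : S → Finset S) : Prop where
  nonneg : ∀ x y, x ≠ y → 0 ≤ Q x y
  diag : ∀ x, -q ≤ Q x x
  mem : ∀ x, x ∈ F x
  supp : ∀ x y, y ∉ F x → Q x y = 0
  sum_eq : ∀ x, ∑ y ∈ F x, Q x y = 0

namespace IsBoundedRateMatrix

variable {Q : Matrix S S ℝ} {q : ℝ} {F : S → Finset S}

theorem hasSum_row (h : IsBoundedRateMatrix Q q F) (x : S) : HasSum (Q x) 0 := by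
  rw [← h.sum_eq x]
  exact hasSum_sum_of_ne_finset_zero fun y hy => h.supp x y hy

variable [DecidableEq S]

theorem sum_abs_le (h : IsBoundedRateMatrix Q q F) (x : S) : ∑ y ∈ F x, |Q x y| ≤ 2 * q := by
  have h1 := h.sum_eq x
  rw [← Finset.add_sum_erase _ _ (h.mem x)] at h1 ⊢
  have h2 : ∑ y ∈ (F x).erase x, |Q x y| = ∑ y ∈ (F x).erase x, Q x y :=
    Finset.sum_congr rfl fun y hy => abs_of_nonneg (h.nonneg x y (Finset.ne_of_mem_erase hy).symm)
  have h3 : 0 ≤ ∑ y ∈ (F x).erase x, Q x y :=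
    Finset.sum_nonneg fun y hy => h.nonneg x y (Finset.ne_of_mem_erase hy).symm
  have h4 := h.diag x
  rw [h2, abs_of_nonpos (by linarith)]
  linarith

theorem norm_row_le (h : IsBoundedRateMatrix Q q F) (x : S) :
    ‖Ell1.ofSummable (Q x) (h.hasSum_row x).summable‖ ≤ 2 * q := by
  rw [Ell1.norm_eq]
  simp only [Ell1.ofSummable_apply, Real.norm_eq_abs]
  rw [tsum_eq_sum (s := F x) fun y hy => by rw [h.supp x y hy, abs_zero]]
  exact h.sum_abs_le x

/-- The operator `f ↦ f Q` on `ℓ¹`. -/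
noncomputable def op (h : IsBoundedRateMatrix Q q F) : Ell1 S →L[ℝ] Ell1 S :=
  Ell1.lift (fun x => Ell1.ofSummable (Q x) (h.hasSum_row x).summable) (2 * q) h.norm_row_le

theorem hasSum_op (h : IsBoundedRateMatrix Q q F) (f : Ell1 S) (y : S) :
    HasSum (fun x => f x * Q x y) (h.op f y) :=
  Ell1.hasSum_lift h.norm_row_le f y

theorem op_unit (h : IsBoundedRateMatrix Q q F) (x y : S) : h.op (Ell1.unit x) y = Q x y := by
  rw [op, Ell1.lift_unit]
  rfl

/-- Conservation of mass: it holds on unit vectors because rows of `Q` sum to zero, and extends by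
continuity. It makes the exponential honest. -/
theorem total_op (h : IsBoundedRateMatrix Q q F) (f : Ell1 S) : Ell1.total (h.op f) = 0 := by
  refine (((Ell1.hasSum_unit f).map h.op h.op.continuous).map Ell1.total
    Ell1.total.continuous).unique ?_
  convert hasSum_zero with x
  have h1 : Ell1.total (h.op (Ell1.unit x)) = 0 := by
    refine (Ell1.hasSum_total _).unique ?_
    exact (funext (h.op_unit x) : ⇑(h.op (Ell1.unit x)) = Q x) ▸ h.hasSum_row x
  simp [h1]

theorem op_add_smul_nonneg (h : IsBoundedRateMatrix Q q F) {f : Ell1 S} (hf : ∀ x, 0 ≤ f x)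
    (y : S) : 0 ≤ (h.op + q • (1 : Ell1 S →L[ℝ] Ell1 S)) f y := by
  have h1 := (h.hasSum_op f y).add (hasSum_pi_single y (q * f y))
  refine h1.nonneg fun x => ?_
  rcases eq_or_ne x y with rfl | hxy
  · simp only [Pi.single_eq_same]
    nlinarith [h.diag x, hf x]
  · simp only [Pi.single_eq_of_ne hxy, add_zero]
    exact mul_nonneg (hf x) (h.nonneg x y hxy)

theorem exp_nonneg (h : IsBoundedRateMatrix Q q F) {t : ℝ} (ht : 0 ≤ t) {f : Ell1 S}
    (hf : ∀ x, 0 ≤ f x) (y : S) : 0 ≤ NormedSpace.exp (t • h.op) f y := by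
  set T := h.op + q • (1 : Ell1 S →L[ℝ] Ell1 S) with hT
  have hpow : ∀ n : ℕ, ∀ y, 0 ≤ ((t • T) ^ n) f y := by
    intro n
    induction n with
    | zero => simpa using hf
    | succ n ih =>
      intro y
      rw [pow_succ', mul_apply_eq_comp]
      exact mul_nonneg ht (h.op_add_smul_nonneg ih y)
  have h1 : 0 ≤ NormedSpace.exp (t • T) f y :=
    ((hasSum_exp_apply (t • T) f).map (Ell1.eval y) (Ell1.eval y).continuous).nonneg fun n =>
        mul_nonneg (by positivity) (hpow n y)
  -- `Q + q` preserves nonnegativity, hence so does its exponential series; the scalar part commutes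
  -- and contributes only the positive factor `exp (-(t q))`.
  have h2 : t • h.op = t • T + algebraMap ℝ (Ell1 S →L[ℝ] Ell1 S) (-(t * q)) := by
    rw [hT, Algebra.algebraMap_eq_smul_one, smul_add, smul_smul, neg_smul, add_neg_cancel_right]
  let _ : NormedAlgebra ℚ (Ell1 S →L[ℝ] Ell1 S) := NormedAlgebra.restrictScalars ℚ ℝ _
  rw [h2, NormedSpace.exp_add_of_commute (Algebra.commute_algebraMap_right _ _),
    ← NormedSpace.algebraMap_exp_comm, Algebra.algebraMap_eq_smul_one, ← Real.exp_eq_exp_ℝ,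
    mul_smul_comm, mul_one]
  exact mul_nonneg (Real.exp_pos _).le h1

/-- The transition function `exp (t Q)`. -/
noncomputable def transition (h : IsBoundedRateMatrix Q q F) (t : ℝ≥0) : Matrix S S ℝ :=
  fun x y => NormedSpace.exp ((t : ℝ) • h.op) (Ell1.unit x) y

theorem exp_add (h : IsBoundedRateMatrix Q q F) (s t : ℝ) (f : Ell1 S) :
    NormedSpace.exp ((s + t) • h.op) f
      = NormedSpace.exp (t • h.op) (NormedSpace.exp (s • h.op) f) := by
  let _ : NormedAlgebra ℚ (Ell1 S →L[ℝ] Ell1 S) := NormedAlgebra.restrictScalars ℚ ℝ _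
  rw [add_comm s t, add_smul, NormedSpace.exp_add_of_commute]
  · rfl
  · exact ((Commute.refl h.op).smul_left t).smul_right s

theorem hasSum_exp_apply (h : IsBoundedRateMatrix Q q F) (t : ℝ≥0) (f : Ell1 S) (y : S) :
    HasSum (fun x => f x * h.transition t x y) (NormedSpace.exp ((t : ℝ) • h.op) f y) := by
  have h1 := ((Ell1.hasSum_unit f).map (NormedSpace.exp ((t : ℝ) • h.op))
    (NormedSpace.exp ((t : ℝ) • h.op)).continuous).map (Ell1.eval y) (Ell1.eval y).continuous
  refine h1.congr_fun ?_ |> fun h => h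
  intro x
  simp [transition]

theorem isTransitionFunction (h : IsBoundedRateMatrix Q q F) :
    IsTransitionFunction Q h.transition where
  nonneg t x y := h.exp_nonneg t.2 (fun k => by
    rw [Ell1.unit_apply, Matrix.one_apply]; split_ifs <;> norm_num) y
  hasSum_one t x := by
    have h1 := Ell1.hasSum_total (NormedSpace.exp ((t : ℝ) • h.op) (Ell1.unit x))
    rw [map_exp_apply_eq (L := Ell1.total) fun f => by simp [h.total_op]] at h1
    have h2 : Ell1.total (Ell1.unit x) = 1 := by
      refine (Ell1.hasSum_total _).unique ?_
      have h3 : ⇑(Ell1.unit x) = fun y => if x = y then (1 : ℝ) else 0 :=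
        funext fun y => by rw [Ell1.unit_apply, Matrix.one_apply]
      rw [h3]
      exact hasSum_ite_eq' x 1
    rwa [h2] at h1
  zero := by
    ext x y
    simp [transition, Ell1.unit_apply]
  chapman_kolmogorov s t x y := by
    have h1 := h.hasSum_exp_apply t (NormedSpace.exp ((s : ℝ) • h.op) (Ell1.unit x)) y
    rwa [← h.exp_add] at h1
  generator x y := by
    have h1 := hasDerivAt_exp_smul_const (𝕂 := ℝ) h.op 0
    have h2 := (((Ell1.eval y).comp
      (ContinuousLinearMap.apply ℝ (Ell1 S) (Ell1.unit x))).hasFDerivAt.comp_hasDerivAt 0 h1)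
    have h3 := h2.tendsto_slope_zero_right
    have h4 : Tendsto (fun h : ℝ≥0 => (h : ℝ)) (𝓝[>] 0) (𝓝[>] 0) := by
      refine tendsto_nhdsWithin_of_tendsto_nhds_of_eventually_within _ ?_ ?_
      · exact (NNReal.continuous_coe.tendsto' 0 0 rfl).mono_left nhdsWithin_le_nhds
      · filter_upwards [self_mem_nhdsWithin] with a ha
        exact NNReal.coe_pos.2 ha
    have h5 := h3.comp h4
    convert h5 using 1
    · ext t
      simp [transition, Ell1.unit_apply, div_eq_inv_mul]
    · simp [h.op_unit]

theorem isStationary (h : IsBoundedRateMatrix Q q F) {p : S → ℝ} (hp : IsDistribution p)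
    (hQ : ∀ y, HasSum (fun x => p x * Q x y) 0) : IsStationary h.transition p := by
  refine ⟨hp, fun t y => ?_⟩
  have h1 : h.op (Ell1.ofSummable p hp.2.summable) = 0 := by
    ext y
    exact (h.hasSum_op _ y).unique (hQ y)
  have h2 := h.hasSum_exp_apply t (Ell1.ofSummable p hp.2.summable) y
  rwa [exp_apply_eq_self (by simp [h1])] at h2

end IsBoundedRateMatrix

end Existence

/-! ### Continuity, the backward equation and uniqueness of the transition function -/

namespace IsTransitionFunction

variable {S : Type*} [DecidableEq S] {Q : Matrix S S ℝ} {P : ℝ≥0 → Matrix S S ℝ}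

theorem le_one (h : IsTransitionFunction Q P) (t : ℝ≥0) (x y : S) : P t x y ≤ 1 :=
  le_hasSum (h.hasSum_one t x) y fun k _ => h.nonneg t x k

theorem sum_mul_le (h : IsTransitionFunction Q P) (F : Finset S) (s t : ℝ≥0) (x y : S) :
    ∑ k ∈ F, P s x k * P t k y ≤ P (s + t) x y :=
  sum_le_hasSum F (fun k _ => mul_nonneg (h.nonneg s x k) (h.nonneg t k y))
    (h.chapman_kolmogorov s t x y)

theorem mul_le (h : IsTransitionFunction Q P) (s t : ℝ≥0) (x k y : S) :
    P s x k * P t k y ≤ P (s + t) x y := by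
  simpa using h.sum_mul_le {k} s t x y

theorem sub_sum_mul_le (h : IsTransitionFunction Q P) (F : Finset S) (s t : ℝ≥0) (x y : S) :
    P (s + t) x y - ∑ k ∈ F, P s x k * P t k y ≤ 1 - ∑ k ∈ F, P s x k := by
  have h1 := sum_le_hasSum F
    (fun k _ => sub_nonneg.2 (mul_le_of_le_one_right (h.nonneg s x k) (h.le_one t k y)))
    ((h.hasSum_one s x).sub (h.chapman_kolmogorov s t x y))
  rw [Finset.sum_sub_distrib] at h1
  linarith

/-- Splitting off the path that is at `x` at time `s` leaves an error in `[0, 1 - P s x x]`. The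
bound does not depend on `t`, so continuity at time `0` spreads to all times. -/
theorem abs_sub_le (h : IsTransitionFunction Q P) (s t : ℝ≥0) (x y : S) :
    |P (s + t) x y - P t x y| ≤ 1 - P s x x := by
  have h1 := h.sum_mul_le {x} s t x y
  have h2 := h.sub_sum_mul_le {x} s t x y
  simp only [Finset.sum_singleton] at h1 h2
  have h3 : 0 ≤ (1 - P s x x) * (1 - P t x y) :=
    mul_nonneg (sub_nonneg.2 (h.le_one _ _ _)) (sub_nonneg.2 (h.le_one _ _ _))
  have h4 : 0 ≤ (1 - P s x x) * P t x y :=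
    mul_nonneg (sub_nonneg.2 (h.le_one _ _ _)) (h.nonneg _ _ _)
  rw [abs_le]
  constructor <;> linarith

theorem tendsto_diag (h : IsTransitionFunction Q P) (x : S) :
    Tendsto (fun t => P t x x) (𝓝 0) (𝓝 1) := by
  have h0 : P 0 x x = 1 := by simp [h.zero]
  have h1 : Tendsto (fun t : ℝ≥0 => (t : ℝ)) (𝓝[>] 0) (𝓝 0) :=
    (NNReal.continuous_coe.tendsto' 0 0 rfl).mono_left nhdsWithin_le_nhds
  have h2 := (h1.mul (h.generator x x)).add_const 1
  rw [zero_mul, zero_add] at h2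
  have h3 : ContinuousWithinAt (fun t => P t x x) (Set.Ioi 0) 0 := by
    rw [ContinuousWithinAt, h0]
    refine h2.congr' ?_
    filter_upwards [self_mem_nhdsWithin] with t ht
    have ht' : (t : ℝ) ≠ 0 := (NNReal.coe_pos.2 ht).ne'
    rw [Matrix.one_apply_eq]
    field_simp
    ring
  rw [continuousWithinAt_Ioi_iff_Ici] at h3
  have h4 : (Set.Ici (0 : ℝ≥0)) = Set.univ := Set.eq_univ_of_forall fun _ => Set.mem_Ici.2 zero_le
  rw [h4, continuousWithinAt_univ, ContinuousAt, h0] at h3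
  exact h3

protected theorem continuous (h : IsTransitionFunction Q P) (x y : S) :
    Continuous fun t => P t x y := by
  rw [continuous_iff_continuousAt]
  intro t
  have hb : ∀ s, dist (P s x y) (P t x y) ≤ 1 - P (nndist s t) x x := by
    intro s
    rw [Real.dist_eq]
    rcases le_total s t with hst | hst
    · have h1 := h.abs_sub_le (t - s) s x y
      rw [tsub_add_cancel_of_le hst, abs_sub_comm] at h1
      rwa [NNReal.nndist_eq, max_eq_right (by rw [tsub_eq_zero_of_le hst]; exact zero_le)]
    · have h1 := h.abs_sub_le (s - t) t x y
      rw [tsub_add_cancel_of_le hst] at h1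
      rwa [NNReal.nndist_eq, max_eq_left (by rw [tsub_eq_zero_of_le hst]; exact zero_le)]
  rw [ContinuousAt, tendsto_iff_dist_tendsto_zero]
  have h2 : Tendsto (fun s => nndist s t) (𝓝 t) (𝓝 0) :=
    (continuous_id.nndist continuous_const).tendsto' _ _ (nndist_self t)
  have h3 := ((h.tendsto_diag x).comp h2).const_sub 1
  rw [sub_self] at h3
  exact squeeze_zero (fun _ => dist_nonneg) hb h3

/-- No interchange of limit and infinite sum is needed: the states outside `F` contribute at most `1
- ∑ k ∈ F, P s x k`, which is `o(s)` because the rates in `F` already sum to zero. -/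
theorem tendsto_slope (h : IsTransitionFunction Q P) {F : Finset S} {x : S} (hx : x ∈ F)
    (hF : ∑ k ∈ F, Q x k = 0) (t : ℝ≥0) (y : S) :
    Tendsto (fun s : ℝ≥0 => (P (s + t) x y - P t x y) / (s : ℝ)) (𝓝[>] 0)
      (𝓝 (∑ k ∈ F, Q x k * P t k y)) := by
  have h1 : Tendsto (fun s : ℝ≥0 => ∑ k ∈ F, (P s x k - (1 : Matrix S S ℝ) x k) / (s : ℝ) * P t k y)
      (𝓝[>] 0) (𝓝 (∑ k ∈ F, Q x k * P t k y)) :=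
    tendsto_finsetSum _ fun k _ => (h.generator x k).mul_const _
  have h2 : Tendsto (fun s : ℝ≥0 => -∑ k ∈ F, (P s x k - (1 : Matrix S S ℝ) x k) / (s : ℝ))
      (𝓝[>] 0) (𝓝 0) := by
    have := (tendsto_finsetSum F fun k _ => h.generator x k).neg
    rwa [hF, neg_zero] at this
  have h3 : Tendsto (fun s : ℝ≥0 => (P (s + t) x y - ∑ k ∈ F, P s x k * P t k y) / (s : ℝ))
      (𝓝[>] 0) (𝓝 0) := by
    refine squeeze_zero (fun s => ?_) (fun s => ?_) h2
    · exact div_nonneg (sub_nonneg.2 (h.sum_mul_le F s t x y)) s.2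
    · have h4 : ∑ k ∈ F, (1 : Matrix S S ℝ) x k = 1 := by
        simp [Matrix.one_apply, hx]
      rw [← Finset.sum_div, Finset.sum_sub_distrib, h4, ← neg_div, neg_sub]
      exact div_le_div_of_nonneg_right (h.sub_sum_mul_le F s t x y) s.2
  have h5 := h3.add h1
  rw [zero_add] at h5
  refine h5.congr fun s => ?_
  have h6 : ∑ k ∈ F, (1 : Matrix S S ℝ) x k * P t k y = P t x y := by
    simp [Matrix.one_apply, hx]
  simp_rw [div_mul_eq_mul_div]
  rw [← Finset.sum_div, ← add_div]
  simp_rw [sub_mul]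
  rw [Finset.sum_sub_distrib, h6]
  ring

/-- The backward equation. -/
theorem hasDerivWithinAt (h : IsTransitionFunction Q P) {F : Finset S} {x : S} (hx : x ∈ F)
    (hF : ∑ k ∈ F, Q x k = 0) {t : ℝ} (ht : 0 ≤ t) (y : S) :
    HasDerivWithinAt (fun s : ℝ => P s.toNNReal x y) (∑ k ∈ F, Q x k * P t.toNNReal k y)
      (Set.Ici t) t := by
  rw [hasDerivWithinAt_iff_tendsto_slope, Set.Ici_sdiff_left]
  have h1 : Tendsto (fun s : ℝ => (s - t).toNNReal) (𝓝[>] t) (𝓝[>] 0) := by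
    refine tendsto_nhdsWithin_of_tendsto_nhds_of_eventually_within _ ?_ ?_
    · refine (Continuous.tendsto' ?_ t 0 (by simp)).mono_left nhdsWithin_le_nhds
      fun_prop
    · filter_upwards [self_mem_nhdsWithin] with s hs
      exact Real.toNNReal_pos.2 (sub_pos.2 hs)
  refine ((h.tendsto_slope hx hF t.toNNReal y).comp h1).congr' ?_
  filter_upwards [self_mem_nhdsWithin] with s hs
  have hs' : 0 ≤ s - t := (sub_pos.2 hs).le
  rw [slope_def_field, Function.comp_apply, ← Real.toNNReal_add hs' ht, sub_add_cancel,
    Real.coe_toNNReal _ hs']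

section Uniqueness

variable {P' : ℝ≥0 → Matrix S S ℝ} {q : ℝ} {F : S → Finset S}

theorem abs_sub_le_mul (h : IsTransitionFunction Q P) (h' : IsTransitionFunction Q P')
    (hb : IsBoundedRateMatrix Q q F) {T M : ℝ} (y : S)
    (hM : ∀ t : ℝ≥0, (t : ℝ) ≤ T → ∀ x, |P t x y - P' t x y| ≤ M)
    (t : ℝ≥0) (ht : (t : ℝ) ≤ T) (x : S) : |P t x y - P' t x y| ≤ 2 * q * M * T := by
  have hM0 : 0 ≤ M := (abs_nonneg _).trans (hM t ht x)
  have hq : 0 ≤ 2 * q := (Finset.sum_nonneg fun _ _ => abs_nonneg _).trans (hb.sum_abs_le x)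
  have h1 := norm_image_sub_le_of_norm_deriv_right_le_segment (a := 0) (b := T)
    (f := fun s : ℝ => P s.toNNReal x y - P' s.toNNReal x y)
    (f' := fun s => ∑ k ∈ F x, Q x k * P s.toNNReal k y - ∑ k ∈ F x, Q x k * P' s.toNNReal k y)
    (C := 2 * q * M) (((h.continuous x y).comp continuous_real_toNNReal).sub
      ((h'.continuous x y).comp continuous_real_toNNReal)).continuousOn
    (fun s hs => (h.hasDerivWithinAt (hb.mem x) (hb.sum_eq x) hs.1 y).sub
      (h'.hasDerivWithinAt (hb.mem x) (hb.sum_eq x) hs.1 y))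
    (fun s hs => by
      rw [← Finset.sum_sub_distrib]
      simp_rw [← mul_sub]
      calc ‖∑ k ∈ F x, Q x k * (P s.toNNReal k y - P' s.toNNReal k y)‖
          ≤ ∑ k ∈ F x, |Q x k| * M := by
            refine norm_sum_le_of_le _ fun k _ => ?_
            rw [norm_mul]
            refine mul_le_mul_of_nonneg_left (hM _ ?_ k) (abs_nonneg _)
            rw [Real.coe_toNNReal _ hs.1]
            exact hs.2.le
        _ ≤ 2 * q * M := by
            rw [← Finset.sum_mul]
            exact mul_le_mul_of_nonneg_right (hb.sum_abs_le x) hM0)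
    t ⟨t.2, ht⟩
  have h2 : P 0 x y - P' 0 x y = 0 := by rw [h.zero, h'.zero, sub_self]
  simp only [Real.toNNReal_coe, Real.toNNReal_zero, h2, sub_zero, Real.norm_eq_abs] at h1
  exact h1.trans (mul_le_mul_of_nonneg_left ht (mul_nonneg hq hM0))

/-- The length `1 / (4 q)` turns the factor `2 q T` of `abs_sub_le_mul` into `1 / 2`, so iterating
the bound drives the difference to zero. -/
theorem eq_of_le (h : IsTransitionFunction Q P) (h' : IsTransitionFunction Q P')
    (hb : IsBoundedRateMatrix Q q F) (hq : 0 < q) (t : ℝ≥0) (ht : (t : ℝ) ≤ 1 / (4 * q)) :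
    P t = P' t := by
  ext x y
  have h1 : ∀ n : ℕ, ∀ t : ℝ≥0, (t : ℝ) ≤ 1 / (4 * q) → ∀ x,
      |P t x y - P' t x y| ≤ (1 / 2) ^ n := by
    intro n
    induction n with
    | zero =>
      intro t _ x
      rw [abs_le, pow_zero]
      constructor <;> linarith [h.nonneg t x y, h'.nonneg t x y, h.le_one t x y, h'.le_one t x y]
    | succ n ih =>
      intro t ht x
      refine (h.abs_sub_le_mul h' hb y ih t ht x).trans_eq ?_
      rw [pow_succ]
      field_simp
      norm_num
  have h2 : |P t x y - P' t x y| ≤ 0 :=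
    ge_of_tendsto' (tendsto_pow_atTop_nhds_zero_of_lt_one (by norm_num) (by norm_num))
      fun n => h1 n t ht x
  exact sub_eq_zero.1 (abs_nonpos_iff.1 h2)

/-- A bounded rate matrix generates only one transition function. -/
theorem eq_of_isBoundedRateMatrix (h : IsTransitionFunction Q P) (h' : IsTransitionFunction Q P')
    (hb : IsBoundedRateMatrix Q q F) (hq : 0 < q) : P = P' := by
  have h1 : ∀ n : ℕ, ∀ t : ℝ≥0, (t : ℝ) ≤ 1 / (4 * q) → P (n * t) = P' (n * t) := by
    intro n t ht
    induction n with
    | zero => simp [h.zero, h'.zero]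
    | succ n ih =>
      ext x y
      rw [Nat.cast_succ, add_mul, one_mul]
      refine (h.chapman_kolmogorov (n * t) t x y).unique ?_
      rw [ih, h.eq_of_le h' hb hq t ht]
      exact h'.chapman_kolmogorov (n * t) t x y
  funext t
  obtain ⟨n, hn⟩ := exists_nat_gt ((t : ℝ) * (4 * q))
  have hn0 : (0 : ℝ) < n := lt_of_le_of_lt (by positivity) hn
  have h2 := h1 n (t / n) (by
    rw [NNReal.coe_div, NNReal.coe_natCast, div_le_div_iff₀ hn0 (by positivity)]
    linarith)
  rwa [mul_div_cancel₀ _ (by exact_mod_cast hn0.ne')] at h2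

end Uniqueness

end IsTransitionFunction

/-! ### Stochastic matrices as contractions of `ℓ¹` -/

section Contraction

variable {S : Type*} {K : S → S → ℝ}

theorem hasSum_tsum_abs_mul (hK : ∀ x y, 0 ≤ K x y) (hK1 : ∀ x, HasSum (K x) 1) {a : S → ℝ}
    (ha : Summable a) : HasSum (fun y => ∑' k, |a k| * K k y) (∑' k, |a k|) := by
  have h1 : Summable fun z : S × S => |a z.1| * K z.1 z.2 := by
    have h0 : 0 ≤ fun z : S × S => |a z.1| * K z.1 z.2 := fun z =>
      mul_nonneg (abs_nonneg _) (hK _ _)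
    refine (summable_prod_of_nonneg h0).2 ⟨fun k => (hK1 k).summable.mul_left |a k|, ?_⟩
    simpa only [tsum_mul_left, (hK1 _).tsum_eq, mul_one] using ha.abs
  have h2 : ∑' z : S × S, |a z.1| * K z.1 z.2 = ∑' k, |a k| := by
    rw [h1.tsum_prod]
    simp only [tsum_mul_left, (hK1 _).tsum_eq, mul_one]
  have h3 := (h1.prod_symm).hasSum.prod_fiberwise fun y => (h1.prod_symm.prod_factor y).hasSum
  rw [← h2, ← (Equiv.prodComm S S).tsum_eq]
  exact h3

theorem summable_abs_mul (hK : ∀ x y, 0 ≤ K x y) (hK1 : ∀ x, HasSum (K x) 1) {a : S → ℝ}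
    (ha : Summable a) (y : S) : Summable fun k => |a k| * K k y :=
  ha.abs.of_nonneg_of_le (fun _ => mul_nonneg (abs_nonneg _) (hK _ _)) fun k =>
    mul_le_of_le_one_right (abs_nonneg _) (le_hasSum (hK1 k) y fun j _ => hK k j)

theorem abs_tsum_mul_le (hK : ∀ x y, 0 ≤ K x y) (hK1 : ∀ x, HasSum (K x) 1) {a : S → ℝ}
    (ha : Summable a) (y : S) : |∑' k, a k * K k y| ≤ ∑' k, |a k| * K k y := by
  have h1 : ∀ k, ‖a k * K k y‖ = |a k| * K k y := fun k => by
    rw [Real.norm_eq_abs, abs_mul, abs_of_nonneg (hK k y)]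
  have h2 := norm_tsum_le_tsum_norm (f := fun k => a k * K k y) (by
    simpa only [h1] using summable_abs_mul hK hK1 ha y)
  simpa only [h1, Real.norm_eq_abs] using h2

theorem summable_abs_tsum_mul (hK : ∀ x y, 0 ≤ K x y) (hK1 : ∀ x, HasSum (K x) 1) {a : S → ℝ}
    (ha : Summable a) : Summable fun y => |∑' k, a k * K k y| :=
  (hasSum_tsum_abs_mul hK hK1 ha).summable.of_nonneg_of_le (fun _ => abs_nonneg _)
    (abs_tsum_mul_le hK hK1 ha)

/-- A stochastic matrix is a contraction of `ℓ¹`. -/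
theorem tsum_abs_tsum_mul_le (hK : ∀ x y, 0 ≤ K x y) (hK1 : ∀ x, HasSum (K x) 1) {a : S → ℝ}
    (ha : Summable a) : ∑' y, |∑' k, a k * K k y| ≤ ∑' k, |a k| := by
  rw [← (hasSum_tsum_abs_mul hK hK1 ha).tsum_eq]
  exact (summable_abs_tsum_mul hK hK1 ha).tsum_le_tsum (abs_tsum_mul_le hK hK1 ha)
    (hasSum_tsum_abs_mul hK hK1 ha).summable

/-- A positive stochastic matrix strictly contracts the nonzero sequences of sum zero. -/
theorem eq_zero_of_tsum_abs_le (hK : ∀ x y, 0 < K x y) (hK1 : ∀ x, HasSum (K x) 1) {a : S → ℝ}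
    (ha : HasSum a 0) (h : ∑' k, |a k| ≤ ∑' y, |∑' k, a k * K k y|) : a = 0 := by
  have hK' := fun x y => (hK x y).le
  by_contra hne
  -- Any single column suffices: equality in its triangle inequality, with positive weights, means
  -- that all `a k` have the same sign, and then the zero sum gives `a = 0`.
  obtain ⟨y, -⟩ := Function.ne_iff.1 hne
  have hs := summable_abs_mul hK' hK1 ha.summable y
  have hs' : Summable fun k => a k * K k y := by
    refine Summable.of_norm (hs.congr fun k => ?_)
    rw [Real.norm_eq_abs, abs_mul, abs_of_nonneg (hK' k y)]
  have h1 : |∑' k, a k * K k y| = ∑' k, |a k| * K k y := by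
    by_contra hlt
    refine absurd h (not_le.2 ?_)
    rw [← (hasSum_tsum_abs_mul hK' hK1 ha.summable).tsum_eq]
    exact (summable_abs_tsum_mul hK' hK1 ha.summable).tsum_lt_tsum
      (abs_tsum_mul_le hK' hK1 ha.summable)
      (lt_of_le_of_ne (abs_tsum_mul_le hK' hK1 ha.summable y) hlt)
      (hasSum_tsum_abs_mul hK' hK1 ha.summable).summable
  have key : ∀ b : S → ℝ, HasSum b 0 → (∀ k, b k = |a k|) → a = 0 := by
    intro b hb hba
    have h2 := (hasSum_zero_iff_of_nonneg fun k => by rw [hba]; exact abs_nonneg _).1 hb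
    funext k
    have h3 := congrFun h2 k
    rw [hba] at h3
    exact abs_eq_zero.1 h3
  rcases abs_choice (∑' k, a k * K k y) with h2 | h2
  · have h3 : HasSum (fun k => |a k| * K k y - a k * K k y) 0 := by
      have := hs.hasSum.sub hs'.hasSum
      rwa [← h1, h2, sub_self] at this
    have h4 := (hasSum_zero_iff_of_nonneg fun k => sub_nonneg.2
      (mul_le_mul_of_nonneg_right (le_abs_self _) (hK' k y))).1 h3
    exact hne (key a ha fun k => (mul_right_cancel₀ (hK k y).ne'
      (sub_eq_zero.1 (congrFun h4 k))).symm)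
  · have h3 : HasSum (fun k => |a k| * K k y - -a k * K k y) 0 := by
      have := hs.hasSum.sub hs'.hasSum.neg
      rw [← h1, h2, sub_self] at this
      simpa only [neg_mul] using this
    have h4 := (hasSum_zero_iff_of_nonneg fun k => sub_nonneg.2
      (mul_le_mul_of_nonneg_right (neg_le_abs _) (hK' k y))).1 h3
    refine hne (key (fun k => -a k) (by simpa using ha.neg) fun k =>
      (mul_right_cancel₀ (hK k y).ne' (sub_eq_zero.1 (congrFun h4 k))).symm)

end Contraction

/-! ### Positivity along paths and convergence to equilibrium -/

namespace IsTransitionFunction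

variable {S : Type*} [DecidableEq S] {Q : Matrix S S ℝ} {P : ℝ≥0 → Matrix S S ℝ}

theorem diag_pos (h : IsTransitionFunction Q P) (t : ℝ≥0) (x : S) : 0 < P t x x := by
  obtain ⟨n, hn0, hn⟩ : ∃ n : ℕ, n ≠ 0 ∧ 0 < P (t / n) x x := by
    have h1 : Tendsto (fun n : ℕ => t / (n : ℝ≥0)) atTop (𝓝 0) :=
      tendsto_const_div_atTop_nhds_zero_nat t
    have h2 := ((h.tendsto_diag x).comp h1).eventually (lt_mem_nhds one_pos)
    obtain ⟨n, hn, hn0⟩ := (h2.and (eventually_ne_atTop 0)).exists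
    exact ⟨n, hn0, hn⟩
  have h3 : ∀ m : ℕ, 0 < P (m * (t / n)) x x := by
    intro m
    induction m with
    | zero => simp [h.zero]
    | succ m ih =>
      rw [Nat.cast_succ, add_mul, one_mul]
      exact (mul_pos ih hn).trans_le (h.mul_le _ _ x x x)
  have h4 := h3 n
  rwa [mul_div_cancel₀ _ (by exact_mod_cast hn0)] at h4

theorem pos_of_rate_pos (h : IsTransitionFunction Q P) {x y : S} (hxy : x ≠ y) (hQ : 0 < Q x y)
    {t : ℝ≥0} (ht : 0 < t) : 0 < P t x y := by
  have h1 := (h.generator x y).eventually (lt_mem_nhds hQ)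
  have h2 : ∀ᶠ s in 𝓝[>] (0 : ℝ≥0), s ∈ Set.Ioo 0 t := Ioo_mem_nhdsGT ht
  obtain ⟨s, hs, hs0, hst⟩ := (h1.and h2).exists
  rw [Matrix.one_apply_ne hxy, sub_zero] at hs
  have h3 : 0 < P s x y := (div_pos_iff_of_pos_right (NNReal.coe_pos.2 hs0)).1 hs
  have h4 := h.mul_le s (t - s) x y y
  rw [add_tsub_cancel_of_le hst.le] at h4
  exact (mul_pos h3 (h.diag_pos _ y)).trans_le h4

/-- The entries of the transition function are positive along paths of positive rates. -/
theorem pos_of_reflTransGen (h : IsTransitionFunction Q P) {x y : S}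
    (hxy : Relation.ReflTransGen (fun a b => a ≠ b ∧ 0 < Q a b) x y) {t : ℝ≥0} (ht : 0 < t) :
    0 < P t x y := by
  induction hxy generalizing t with
  | refl => exact h.diag_pos t x
  | @tail b c _ hbc ih =>
    have h1 := h.mul_le (t / 2) (t / 2) x b c
    rw [add_halves] at h1
    exact (mul_pos (ih (half_pos ht)) (h.pos_of_rate_pos hbc.1 hbc.2 (half_pos ht))).trans_le h1

/-- A summable bound on the rows, uniform in time: no mass escapes to infinity, and dominated
convergence applies along any sequence of times. -/
theorem le_div_of_isStationary (h : IsTransitionFunction Q P) {p : S → ℝ} (hp : IsStationary P p)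
    (hpos : ∀ x, 0 < p x) (t : ℝ≥0) (x y : S) : P t x y ≤ p y / p x := by
  rw [le_div_iff₀' (hpos x)]
  exact le_hasSum (hp.2 t y) x fun k _ => mul_nonneg (hpos k).le (h.nonneg t k y)

theorem sub_eq_tsum (h : IsTransitionFunction Q P) {p : S → ℝ} (hp : IsStationary P p)
    (s t : ℝ≥0) (x y : S) : P (s + t) x y - p y = ∑' k, (P s x k - p k) * P t k y := by
  have h1 := (h.chapman_kolmogorov s t x y).sub (hp.2 t y)
  simp_rw [← sub_mul] at h1
  exact h1.tsum_eq.symm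

/-- An irreducible chain with a stationary distribution converges to it. -/
theorem tendsto_of_isStationary (h : IsTransitionFunction Q P) {p : S → ℝ}
    (hp : IsStationary P p) (hpos : ∀ x, 0 < p x) (hP : ∀ x y, 0 < P 1 x y) (x y : S) :
    Tendsto (fun t => P t x y) atTop (𝓝 (p y)) := by
  set f : ℝ≥0 → ℝ := fun t => ∑' k, |P t x k - p k| with hf
  have hsum : ∀ t, Summable fun k => P t x k - p k := fun t =>
    (h.hasSum_one t x).summable.sub hp.1.2.summable
  have hanti : Antitone f := by
    intro s t hst
    have h1 := tsum_abs_tsum_mul_le (h.nonneg (t - s)) (h.hasSum_one (t - s)) (hsum s)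
    simp_rw [← h.sub_eq_tsum hp, add_tsub_cancel_of_le hst] at h1
    exact h1
  obtain ⟨d, hd⟩ : ∃ d, Tendsto f atTop (𝓝 d) :=
    ⟨_, tendsto_atTop_ciInf hanti ⟨0, by
      rintro _ ⟨t, rfl⟩
      exact tsum_nonneg fun _ => abs_nonneg _⟩⟩
  -- Along an ultrafilter every bounded coordinate converges, which replaces the extraction of a
  -- diagonal subsequence.
  rw [tendsto_iff_ultrafilter]
  intro U hU
  have hlim : ∀ k, ∃ v, Tendsto (fun t => P t x k) U (𝓝 v) := fun k => by
    obtain ⟨v, -, hv⟩ := (isCompact_Icc (a := (0 : ℝ)) (b := 1)).ultrafilter_le_nhds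
      (U.map fun t => P t x k) (by
        rw [le_principal_iff]
        exact Filter.mem_map.2 (univ_mem' fun t => ⟨h.nonneg t x k, h.le_one t x k⟩))
    exact ⟨v, hv⟩
  choose v hv using hlim
  have hdom : Summable fun k => p k / p x := hp.1.2.summable.div_const _
  have hle : ∀ t k, ‖P t x k‖ ≤ p k / p x := fun t k => by
    rw [Real.norm_of_nonneg (h.nonneg t x k)]
    exact h.le_div_of_isStationary hp hpos t x k
  have hvle : ∀ k, ‖v k‖ ≤ p k / p x := fun k => le_of_tendsto' (hv k).norm fun t => hle t k
  have hvs : Summable v := Summable.of_norm_bounded hdom hvle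
  have hdom' : Summable fun k => p k / p x + p k := hdom.add hp.1.2.summable
  have hle' : ∀ t k, ‖P t x k - p k‖ ≤ p k / p x + p k := fun t k =>
    (norm_sub_le _ _).trans (add_le_add (hle t k) (Real.norm_of_nonneg (hpos k).le).le)
  have hv1 : HasSum v 1 := by
    have h1 := tendsto_tsum_of_dominated_convergence hdom hv (Eventually.of_forall hle)
    simp_rw [(h.hasSum_one _ x).tsum_eq] at h1
    rw [← tendsto_nhds_unique h1 tendsto_const_nhds]
    exact hvs.hasSum
  have hnorm : ∑' k, |v k - p k| = d := by
    refine tendsto_nhds_unique ?_ (hd.mono_left hU)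
    refine tendsto_tsum_of_dominated_convergence hdom' (fun k => ((hv k).sub_const _).abs)
      (Eventually.of_forall fun t k => ?_)
    rw [Real.norm_eq_abs, abs_abs]
    exact hle' t k
  have hstep : ∀ k, Tendsto (fun t => P (t + 1) x k - p k) U
      (𝓝 (∑' j, (v j - p j) * P 1 j k)) := fun k => by
    simp_rw [h.sub_eq_tsum hp]
    refine tendsto_tsum_of_dominated_convergence hdom' (fun j => ((hv j).sub_const _).mul_const _)
      (Eventually.of_forall fun t j => ?_)
    rw [norm_mul, Real.norm_of_nonneg (h.nonneg 1 j k)]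
    exact (mul_le_of_le_one_right (norm_nonneg _) (h.le_one 1 j k)).trans (hle' t j)
  -- The distances at times `t` and `t + 1` have the same limit, so applying `P 1` to the limit `v -
  -- p` does not shrink its norm.
  have hnorm' : ∑' k, |∑' j, (v j - p j) * P 1 j k| = d := by
    have h1 : Tendsto (fun t => t + 1) atTop (atTop : Filter ℝ≥0) :=
      tendsto_atTop_mono (fun _ => le_add_of_nonneg_right zero_le) tendsto_id
    have h2 : Tendsto (fun t => ∑' k, |P (t + 1) x k - p k|) U (𝓝 d) := (hd.comp h1).mono_left hU
    refine tendsto_nhds_unique ?_ h2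
    refine tendsto_tsum_of_dominated_convergence hdom' (fun k => (hstep k).abs)
      (Eventually.of_forall fun t k => ?_)
    rw [Real.norm_eq_abs, abs_abs]
    exact hle' (t + 1) k
  have h0 := eq_zero_of_tsum_abs_le hP (h.hasSum_one 1) (a := fun k => v k - p k)
    (by simpa using hv1.sub hp.1.2) (by rw [hnorm, hnorm'])
  have h1 : v y = p y := sub_eq_zero.1 (congrFun h0 y)
  rw [← h1]
  exact hv y

theorem isLimiting (h : IsTransitionFunction Q P) {p : S → ℝ}
    (hp : IsStationary P p) (hpos : ∀ x, 0 < p x) (hP : ∀ x y, 0 < P 1 x y) :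
    IsLimiting P p := by
  intro ν hν y
  have h1 := tendsto_tsum_of_dominated_convergence (𝓕 := atTop) hν.2.summable
    (fun x => (h.tendsto_of_isStationary hp hpos hP x y).const_mul (ν x))
    (Eventually.of_forall fun t x => by
      rw [Real.norm_of_nonneg (mul_nonneg (hν.1 x) (h.nonneg t x y))]
      exact mul_le_of_le_one_right (hν.1 x) (h.le_one t x y))
  rwa [tsum_mul_right, hν.2.tsum_eq, one_mul] at h1

end IsTransitionFunction

theorem IsLimiting.eq_of_isStationary {S : Type*} {P : ℝ≥0 → Matrix S S ℝ} {p p' : S → ℝ}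
    (h : IsLimiting P p) (hp' : IsStationary P p') : p' = p := by
  funext y
  have h1 := h p' hp'.1 y
  simp_rw [(hp'.2 _ y).tsum_eq] at h1
  exact tendsto_nhds_unique tendsto_const_nhds h1

/-! ### The modified network: irreducibility, global balance and equilibrium -/

section Network

variable {lam μ₁ μ₂ : ℝ} {a : ℕ → ℝ}

/-- The states that can be reached from a state of the tandem network in at most one step. -/
def neighbours : ℕ × ℕ → Finset (ℕ × ℕ)
  | (0, 0) => {(0, 0), (0, 1)}
  | (0, i + 1) => {(0, i + 1), (0, i + 2), (1, i)}
  | (n + 1, 0) => {(n + 1, 0), (n + 1, 1), (n, 0)}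
  | (n + 1, i + 1) => {(n + 1, i + 1), (n + 1, i + 2), (n + 2, i), (n, i + 1)}

theorem generator_nonneg (hlam : 0 ≤ lam) (hμ₁ : 0 ≤ μ₁) (hμ₂ : 0 ≤ μ₂) (ha : ∀ i, 0 ≤ a i)
    {x y : ℕ × ℕ} (hxy : x ≠ y) : 0 ≤ generator lam μ₁ μ₂ a x y := by
  obtain ⟨n, i⟩ := x
  obtain ⟨m, j⟩ := y
  have h : ¬ (n = m ∧ i = j) := fun h => hxy (by rw [h.1, h.2])
  simp only [generator, qbdGenerator, blockUp, blockDown, blockLocal, blockZero]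
  split_ifs <;> first | positivity | exact ha _ | (exfalso; lia)

theorem generator_eq_zero {x y : ℕ × ℕ} (hxy : y ∉ neighbours x) :
    generator lam μ₁ μ₂ a x y = 0 := by
  obtain ⟨n, i⟩ := x
  obtain ⟨m, j⟩ := y
  cases n <;> cases i <;>
    simp only [neighbours, Finset.mem_insert, Finset.mem_singleton, Prod.mk.injEq] at hxy <;>
    simp only [generator, qbdGenerator, blockUp, blockDown, blockLocal, blockZero] <;>
    split_ifs <;> first | rfl | (exfalso; lia)

theorem isBoundedRateMatrix_generator (hlam : 0 ≤ lam) (hμ₁ : 0 ≤ μ₁) (hμ₂ : 0 ≤ μ₂)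
    (ha : ∀ i, 0 ≤ a i) {C : ℝ} (hC : ∀ i, a i ≤ C) :
    IsBoundedRateMatrix (generator lam μ₁ μ₂ a) (C + lam + μ₁ + μ₂) neighbours where
  nonneg _ _ hxy := generator_nonneg hlam hμ₁ hμ₂ ha hxy
  diag := by
    rintro ⟨n, i⟩
    have h1 := hC i
    have h2 := ha i
    simp only [generator, qbdGenerator, blockLocal, blockZero]
    split_ifs <;> first | (exfalso; lia) | linarith
  mem := by
    rintro ⟨_ | n, _ | i⟩ <;> simp [neighbours]
  supp _ _ := generator_eq_zero
  sum_eq := by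
    rintro ⟨_ | n, _ | i⟩ <;> simp only [neighbours]
    · rw [Finset.sum_pair (by simp)]
      simp [generator, qbdGenerator, blockZero]
    · rw [Finset.sum_insert (by simp), Finset.sum_pair (by simp)]
      simp [generator, qbdGenerator, blockZero, blockUp]
    · rw [Finset.sum_insert (by simp), Finset.sum_pair (by simp)]
      simp [generator, qbdGenerator, blockLocal, blockDown, show n ≠ n + 1 + 1 by lia]
    · rw [Finset.sum_insert (by simp), Finset.sum_insert (by simp), Finset.sum_pair (by simp)]
      simp [generator, qbdGenerator, blockLocal, blockUp, blockDown,
        show n ≠ n + 1 + 1 by lia]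
      ring

theorem reflTransGen_generator (hμ₁ : 0 < μ₁) (hμ₂ : 0 < μ₂) (ha : ∀ i, 0 < a i)
    (x y : ℕ × ℕ) :
    Relation.ReflTransGen (fun x y => x ≠ y ∧ 0 < generator lam μ₁ μ₂ a x y) x y := by
  set r : ℕ × ℕ → ℕ × ℕ → Prop := fun x y => x ≠ y ∧ 0 < generator lam μ₁ μ₂ a x y
  have hdown : ∀ n i, r (n + 1, i) (n, i) := fun n i => by
    refine ⟨by simp, ?_⟩
    simpa [generator, qbdGenerator, blockDown, show n ≠ n + 1 + 1 by lia] using hμ₂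
  have hup : ∀ n i, r (n, i + 1) (n + 1, i) := fun n i => by
    refine ⟨by simp, ?_⟩
    simpa [generator, qbdGenerator, blockUp] using hμ₁
  have harr : ∀ i, r (0, i) (0, i + 1) := fun i => by
    refine ⟨by simp, ?_⟩
    simpa [generator, qbdGenerator, blockZero] using ha i
  have hempty : ∀ n i, Relation.ReflTransGen r (n, i) (0, i) := by
    intro n i
    induction n with
    | zero => exact .refl
    | succ n ih => exact .head (hdown n i) ih
  have hzero : ∀ i, Relation.ReflTransGen r (0, i) (0, 0) := by
    intro i
    induction i with
    | zero => exact .refl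
    | succ i ih => exact .head (hup 0 i) ((hempty 1 i).trans ih)
  have hfill : ∀ i, Relation.ReflTransGen r (0, 0) (0, i) := by
    intro i
    induction i with
    | zero => exact .refl
    | succ i ih => exact .tail ih (harr i)
  have hmove : ∀ n i, Relation.ReflTransGen r (0, n + i) (n, i) := by
    intro n
    induction n with
    | zero => intro i; rw [zero_add]
    | succ n ih =>
      intro i
      have h1 := ih (i + 1)
      rw [← add_assoc, Nat.add_right_comm] at h1
      exact .tail h1 (hup n i)
  exact (((hempty _ _).trans (hzero x.2)).trans (hfill (y.1 + y.2))).trans (hmove _ _)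

/-- The global balance equations of the network for a measure of the form `c z ^ n u i`. -/
theorem hasSum_geometric_mul_generator {c z : ℝ} {u : ℕ → ℝ}
    (hu0 : μ₁ * u 1 = (lam + μ₂ * (1 - z)) * z * u 0)
    (hu : ∀ k, μ₁ * u (k + 2) = (lam + μ₁ + μ₂ * (1 - z)) * z * u (k + 1) - lam * z * u k)
    (ha0 : a 0 = μ₂ * z)
    (ha : ∀ i, a (i + 1) * u (i + 1) = a i * u i + (μ₂ * z - μ₁) * u (i + 1)) (y : ℕ × ℕ) :
    HasSum (fun x : ℕ × ℕ => c * z ^ x.1 * u x.2 * generator lam μ₁ μ₂ a x y) 0 := by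
  -- Column `y` of the generator is finitely supported, so it suffices to sum over a finite set
  -- containing all predecessors of `y`.
  have key : ∀ s : Finset (ℕ × ℕ), (∀ x, y ∈ neighbours x → x ∈ s) →
      ∑ x ∈ s, c * z ^ x.1 * u x.2 * generator lam μ₁ μ₂ a x y = 0 →
      HasSum (fun x : ℕ × ℕ => c * z ^ x.1 * u x.2 * generator lam μ₁ μ₂ a x y) 0 := by
    intro s hs h0
    rw [← h0]
    exact hasSum_sum_of_ne_finset_zero fun x hx => by
      rw [generator_eq_zero fun h => hx (hs x h), mul_zero]
  obtain ⟨_ | n, _ | j⟩ := y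
  · refine key {(0, 0), (1, 0)} ?_ ?_
    · rintro ⟨_ | m, _ | i⟩ <;> simp [neighbours] <;> lia
    · rw [Finset.sum_pair (by simp)]
      simp [generator, qbdGenerator, blockZero, blockDown, ha0]
      ring
  · refine key {(0, j), (0, j + 1), (1, j + 1)} ?_ ?_
    · rintro ⟨_ | m, _ | i⟩ <;> simp [neighbours] <;> lia
    · rw [Finset.sum_insert (by simp), Finset.sum_pair (by simp)]
      simp [generator, qbdGenerator, blockZero, blockDown]
      linear_combination (-c) * ha j
  · refine key {(n, 1), (n + 1, 0), (n + 2, 0)} ?_ ?_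
    · rintro ⟨_ | m, _ | i⟩ <;> simp [neighbours] <;> lia
    · rw [Finset.sum_insert (by simp), Finset.sum_pair (by simp)]
      simp [generator, qbdGenerator, blockLocal, blockUp, blockDown]
      linear_combination c * z ^ n * hu0
  · refine key {(n, j + 2), (n + 1, j), (n + 1, j + 1), (n + 2, j + 1)} ?_ ?_
    · rintro ⟨_ | m, _ | i⟩ <;> simp [neighbours] <;> lia
    · rw [Finset.sum_insert (by simp), Finset.sum_insert (by simp), Finset.sum_pair (by simp)]
      simp [generator, qbdGenerator, blockLocal, blockUp, blockDown]
      linear_combination c * z ^ n * hu j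

theorem hasDecayRate_of_eq {f : ℕ → ℝ} {z κ : ℝ} (hz : 0 < z) (hκ : 0 < κ)
    (hf : ∀ n, f n = κ * z ^ n) : HasDecayRate f z := by
  refine ⟨hz, κ, hκ, tendsto_const_nhds.congr fun n => ?_⟩
  rw [hf, mul_div_cancel_right₀ _ (pow_pos hz n).ne']

theorem modified_network_equilibrium {z : ℝ} (hlam : 0 < lam) (hstable : lam < μ₂) (hμ : μ₂ < μ₁)
    (hz : lam / μ₂ ≤ z) (hz1 : z < 1) :
    ∃ (P : ℝ≥0 → Matrix (ℕ × ℕ) (ℕ × ℕ) ℝ) (c : ℝ) (p : ℕ × ℕ → ℝ),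
      (∀ P', IsTransitionFunction (generator lam μ₁ μ₂ (modifiedRate lam μ₁ μ₂ z)) P' ↔ P' = P) ∧
      0 < c ∧
      (∀ n i, p (n, i) = c * z ^ n * w lam μ₁ μ₂ z i) ∧
      (∀ p', IsStationary P p' ↔ p' = p) ∧
      IsLimiting P p ∧
      HasDecayRate (fun n => ∑' i, p (n, i)) z ∧
      ∀ i, HasDecayRate (fun n => p (n, i)) z := by
  have hμ₂ : 0 < μ₂ := hlam.trans hstable
  have hμ₁ : 0 < μ₁ := hμ₂.trans hμ
  have hz0 : 0 < z := (div_pos hlam hμ₂).trans_le hz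
  have hw := w_pos hlam hstable hμ hz hz1
  have hws := summable_w hlam hstable hμ hz hz1
  have ha := modifiedRate_pos hlam hstable hμ hz hz1
  obtain ⟨C, hC⟩ := exists_modifiedRate_le hlam hstable hμ hz hz1
  have hb := isBoundedRateMatrix_generator hlam.le hμ₁.le hμ₂.le (fun i => (ha i).le) hC
  have hq : 0 < C + lam + μ₁ + μ₂ := by linarith [(ha 0).trans_le (hC 0)]
  have hW : 0 < ∑' i, w lam μ₁ μ₂ z i := hws.tsum_pos (fun i => (hw i).le) 0 (hw 0)
  -- Normalization: the total mass of `z ^ n * w i` is `(1 - z)⁻¹ * ∑ w`.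
  set c := (1 - z) / ∑' i, w lam μ₁ μ₂ z i with hc
  have hc0 : 0 < c := div_pos (sub_pos.2 hz1) hW
  set p : ℕ × ℕ → ℝ := fun x => c * z ^ x.1 * w lam μ₁ μ₂ z x.2 with hp
  have hpos : ∀ x, 0 < p x := fun x => mul_pos (mul_pos hc0 (pow_pos hz0 _)) (hw _)
  have hdist : IsDistribution p := by
    refine ⟨fun x => (hpos x).le, ?_⟩
    have hg := (hasSum_geometric_of_lt_one hz0.le hz1).mul_left c
    have h1 := hg.mul hws.hasSum (hg.summable.mul_of_nonneg hws
      (fun n => mul_nonneg hc0.le (pow_nonneg hz0.le n)) fun i => (hw i).le)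
    have h2 : c * (1 - z)⁻¹ * ∑' i, w lam μ₁ μ₂ z i = 1 := by
      have := (sub_pos.2 hz1).ne'
      rw [hc]
      field_simp
    rwa [h2] at h1
  have hP := hb.isTransitionFunction
  have hstat : IsStationary hb.transition p := by
    refine hb.isStationary hdist (hasSum_geometric_mul_generator ?_ (mul_w_add_two hμ₁.ne') ?_ ?_)
    · rw [mul_w_one hμ₁.ne', w, mul_one]
    · rw [modifiedRate]
    · intro i
      have := (hw (i + 1)).ne'
      rw [modifiedRate]
      field_simp
      ring
  have hlim : IsLimiting hb.transition p := hP.isLimiting hstat hpos fun x y =>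
    hP.pos_of_reflTransGen (reflTransGen_generator hμ₁ hμ₂ ha x y) one_pos
  refine ⟨hb.transition, c, p, fun P' => ⟨fun h => h.eq_of_isBoundedRateMatrix hP hb hq, ?_⟩, hc0,
    fun n i => rfl, fun p' => ⟨fun h => hlim.eq_of_isStationary h, ?_⟩, hlim,
    hasDecayRate_of_eq hz0 (mul_pos hc0 hW) fun n => ?_,
    fun i => hasDecayRate_of_eq hz0 (mul_pos hc0 (hw i)) fun n => ?_⟩
  · rintro rfl
    exact hP
  · rintro rfl
    exact hstat
  · simp only [hp]
    rw [tsum_mul_left]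
    ring
  · simp only [hp]
    ring

end Network

end TandemQueue

theorem proposition6p1 (lam μ₁ μ₂ z : ℝ) (hlam : 0 < lam) (hstable : lam < μ₂) (hμ : μ₂ < μ₁)
    (hz : lam / μ₂ ≤ z) (hz1 : z < 1) :
    -- the vector `w` is positive and summable,
    (∀ k, 0 < TandemQueue.w lam μ₁ μ₂ z k) ∧
    Summable (TandemQueue.w lam μ₁ μ₂ z) ∧
    -- it solves `w (Q₀ + z Q₁ + z² Q₂) = 0` and is the only solution with `w 0 = 1`,
    (∀ v : ℕ → ℝ, (v 0 = 1 ∧ ∀ j, ∑' i, v i * (TandemQueue.blockUp μ₁ i j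
        + z * TandemQueue.blockLocal lam μ₁ μ₂ i j + z ^ 2 * TandemQueue.blockDown μ₂ i j) = 0) ↔
      v = TandemQueue.w lam μ₁ μ₂ z) ∧
    -- and it satisfies `w R = z w` for the minimal nonnegative solution `R`
    (∃ R, TandemQueue.IsRateMatrix (TandemQueue.blockUp μ₁) (TandemQueue.blockLocal lam μ₁ μ₂)
        (TandemQueue.blockDown μ₂) R ∧
      ∀ j, HasSum (fun i => TandemQueue.w lam μ₁ μ₂ z i * R i j)
        (z * TandemQueue.w lam μ₁ μ₂ z j)) ∧
    -- the modified rates are strictly positive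
    (∀ i, 0 < TandemQueue.modifiedRate lam μ₁ μ₂ z i) ∧
    -- the modified network is a well-defined Markov chain whose stationary distribution is
    -- `(n, i) ↦ c z ^ n w i`, with decay rate `z`
    ∃ (P : ℝ≥0 → Matrix (ℕ × ℕ) (ℕ × ℕ) ℝ) (c : ℝ) (p : ℕ × ℕ → ℝ),
      (∀ P', TandemQueue.IsTransitionFunction
        (TandemQueue.generator lam μ₁ μ₂ (TandemQueue.modifiedRate lam μ₁ μ₂ z)) P' ↔ P' = P) ∧
      0 < c ∧
      (∀ n i, p (n, i) = c * z ^ n * TandemQueue.w lam μ₁ μ₂ z i) ∧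
      (∀ p', TandemQueue.IsStationary P p' ↔ p' = p) ∧
      TandemQueue.IsLimiting P p ∧
      TandemQueue.HasDecayRate (fun n => ∑' i, p (n, i)) z ∧
      ∀ i, TandemQueue.HasDecayRate (fun n => p (n, i)) z := by
  exact ⟨TandemQueue.w_pos hlam hstable hμ hz hz1, TandemQueue.summable_w hlam hstable hμ hz hz1,
    TandemQueue.column_equations_iff ((hlam.trans hstable).trans hμ).ne',
    TandemQueue.exists_isRateMatrix hlam hstable hμ hz hz1,
    TandemQueue.modifiedRate_pos hlam hstable hμ hz hz1,
    TandemQueue.modified_network_equilibrium hlam hstable hμ hz hz1⟩
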